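/- Let $\eta$ be the Dedekind eta function, $G_{2k}(T)=\sum_{(c,d)\in\mathbb Z^2\setminus\{(0,0)\}}(cT+d)^{-2k}$ $(k\ge 2)$ the holomorphic Eisenstein series, $j=1/q+744+\cdots$ the $j$-invariant, $G_2$ the quasi-modular Eisenstein series of weight $2$ (normalised by $\frac{d}{dT}\ln\eta=\frac{i}{4\pi}G_2$), and $\widehat G_2(T,\bar T)=G_2(T)+\frac{2\pi}{i(T-\bar T)}$. Let $m,n\ge 0$ be integers, let $\mathcal P$ be a complex polynomial, and put $$H(T)=\Big(\frac{G_4(T)}{\eta^8(T)}\Big)^n\Big(\frac{G_6(T)}{\eta^{12}(T)}\Big)^m\mathcal P(j(T)),\qquad \operatorname{Im}T>0 .$$ Let $\Omega$ be holomorphic on an open set $U\subseteq\{S\in\mathbb C:\operatorname{Re}S>0\}$. Consider $$\mathcal K=-\ln(S+\bar S)-3\ln\big(-i(T-\bar T)\big),\qquad W(S,T)=\frac{\Omega(S)H(T)}{\eta^6(T)},$$ and the scalar potential $V(T,S)=e^{\mathcal K}\big(\mathcal K^{a\bar b}F_a\bar F_{\bar b}-3|W|^2\big)$, where $F_a=\partial_aW+(\partial_a\mathcal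 K)W$ for $a\in\{T,S\}$ and $\mathcal K^{a\bar b}$ is the inverse of the Kähler metric $\mathcal K_{a\bar b}=\partial_a\partial_{\bar b}\mathcal K$. Call $(T_0,S_0)$ an extremum if $\partial_TV=\partial_SV=0$ there, and a de Sitter vacuum if it is an extremum with $V(T_0,S_0)>0$ at which all eigenvalues of the (real $4\times4$) Hessian of $V$ in the coordinates $(\operatorname{Re}T,\operatorname{Im}T,\operatorname{Re}S,\operatorname{Im}S)$ are $\ge 0$. Put $\widetilde F_T=H_T-\frac{3i}{2\pi}\widehat G_2H$ and $\widetilde F_S=\Omega_S-\frac{1}{S+\bar S}\Omega$. Let $\rho=e^{2\pi i/3}$. Then: 1. For every $S_0\in U$, neither $(i,S_0)$ nor $(\rho,S_0)$ is a de Sitter vacuum. 2. If $\mathcal P(0)\ne0$ and $\mathcal P(1728)\neq 0$, then $\widetilde F_T(i)=0$ if and only if $m\ne1$, and $\widetilde F_T(\rho)=0$ if and only if $n\neq 1$. 3. If $m=1$, then every extremum $(i,S_0)$ with $S_0\in U$ and $V(i,S_0)>0$ is of Class A, that is, $\widetilde F_S(S_0)=0$; if $n=1$, the same holds for every extremum $(\rho,S_0)$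 with $S_0\in U$ and $V(\rho,S_0)>0$. -/

import Mathlib

open Complex ComplexConjugate
open scoped UpperHalfPlane

noncomputable section

namespace HeteroticOrbifold

/-! ### Modular building blocks -/

/-- The holomorphic Eisenstein series `G_k(T) = ∑' (c T + d)^(-k)` over pairs of integers
`(c, d) ≠ (0, 0)`; the pair `(0, 0)` contributes `0⁻¹ ^ k = 0` to the sum below. -/
def eisG (k : ℕ) (T : ℂ) : ℂ :=
  ∑' v : Fin 2 → ℤ, ((v 0 : ℂ) * T + (v 1 : ℂ)) ^ (-(k : ℤ))

/-- The `j`-invariant `j = E₄³ / Δ = 1/q + 744 + ⋯`, with `E₄ = G₄ / (2 ζ(4))` and `Δ = η²⁴`. -/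
def jInvariant (T : ℂ) : ℂ :=
  (eisG 4 T / (2 * riemannZeta 4)) ^ 3 / ModularForm.eta T ^ 24

/-- `H(T) = (G₄/η⁸)ⁿ (G₆/η¹²)ᵐ P(j(T))`. -/
def modularH (m n : ℕ) (P : Polynomial ℂ) (T : ℂ) : ℂ :=
  (eisG 4 T / ModularForm.eta T ^ 8) ^ n * (eisG 6 T / ModularForm.eta T ^ 12) ^ m *
    P.eval (jInvariant T)

/-- The non-holomorphic Eisenstein series `Ĝ₂(T, T̄) = G₂(T) + 2π / (i (T - T̄))`. -/
def hatG2 (T : ℍ) : ℂ :=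
  EisensteinSeries.G2 T + 2 * Real.pi / (I * ((T : ℂ) - conj (T : ℂ)))

/-! ### Four-dimensional `N = 1` supergravity with two chiral fields

A point of field space is `φ : Fin 2 → ℂ` with `φ 0 = T` and `φ 1 = S`. -/

/-- The Wirtinger derivative `∂_a = (∂_x - i ∂_y) / 2` in the field `φ a = x + i y`. -/
def wirtinger (a : Fin 2) (f : (Fin 2 → ℂ) → ℂ) (φ : Fin 2 → ℂ) : ℂ :=
  (fderiv ℝ f φ (Pi.single a 1) - I * fderiv ℝ f φ (Pi.single a I)) / 2

/-- The Wirtinger derivative `∂_ā = (∂_x + i ∂_y) / 2` in the field `φ a = x + i y`. -/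
def wirtingerBar (a : Fin 2) (f : (Fin 2 → ℂ) → ℂ) (φ : Fin 2 → ℂ) : ℂ :=
  (fderiv ℝ f φ (Pi.single a 1) + I * fderiv ℝ f φ (Pi.single a I)) / 2

/-- The Kähler metric `K_{a b̄} = ∂_a ∂_b̄ K`. -/
def kahlerMetric (K : (Fin 2 → ℂ) → ℝ) (φ : Fin 2 → ℂ) : Matrix (Fin 2) (Fin 2) ℂ :=
  Matrix.of fun a b => wirtinger a (wirtingerBar b fun ψ => (K ψ : ℂ)) φ

/-- The F-term `F_a = ∂_a W + (∂_a K) W`. -/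
def fTerm (K : (Fin 2 → ℂ) → ℝ) (W : (Fin 2 → ℂ) → ℂ) (a : Fin 2) (φ : Fin 2 → ℂ) : ℂ :=
  wirtinger a W φ + wirtinger a (fun ψ => (K ψ : ℂ)) φ * W φ

/-- The F-term scalar potential `V = e^K (K^{a b̄} F_a F̄_b̄ - 3 |W|²)`, where `K^{a b̄}` is
determined by `∑_b K^{a b̄} K_{c b̄} = δ_{a c}`. The double sum is real for a Hermitian metric. -/
def scalarPotential (K : (Fin 2 → ℂ) → ℝ) (W : (Fin 2 → ℂ) → ℂ) (φ : Fin 2 → ℂ) : ℝ :=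
  Real.exp (K φ) *
    ((∑ a, ∑ b, ((kahlerMetric K φ).transpose)⁻¹ a b * fTerm K W a φ * conj (fTerm K W b φ)).re
      - 3 * ‖W φ‖ ^ 2)

/-! ### Extrema and de Sitter vacua -/

/-- `∂_a V = 0` for both fields; as `V` is real, this is the vanishing of its full gradient. -/
def IsExtremum (V : (Fin 2 → ℂ) → ℝ) (φ : Fin 2 → ℂ) : Prop :=
  ∀ a, wirtinger a (fun ψ => (V ψ : ℂ)) φ = 0

/-- The four real coordinate directions `(Re T, Im T, Re S, Im S)` of field space. -/
def realDirection : Fin 4 → (Fin 2 → ℂ) :=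
  ![Pi.single 0 1, Pi.single 0 I, Pi.single 1 1, Pi.single 1 I]

/-- The real `4 × 4` Hessian matrix of `V` in the coordinates `(Re T, Im T, Re S, Im S)`. -/
def hessian (V : (Fin 2 → ℂ) → ℝ) (φ : Fin 2 → ℂ) : Matrix (Fin 4) (Fin 4) ℝ :=
  Matrix.of fun i j =>
    fderiv ℝ (fun ψ => fderiv ℝ V ψ (realDirection j)) φ (realDirection i)

/-- A de Sitter vacuum: an extremum of positive energy at which every eigenvalue of the Hessian
is nonnegative. -/
def IsDeSitterVacuum (V : (Fin 2 → ℂ) → ℝ) (φ : Fin 2 → ℂ) : Prop :=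
  0 < V φ ∧ IsExtremum V φ ∧
    ∀ μ : ℝ, Module.End.HasEigenvalue (Matrix.toLin' (hessian V φ)) μ → 0 ≤ μ

/-! ### The two-modulus model -/

/-- The Kähler potential `K = -ln(S + S̄) - 3 ln(-i (T - T̄))`, with `S + S̄ = 2 Re S` and
`-i (T - T̄) = 2 Im T`. -/
def treeKahler (φ : Fin 2 → ℂ) : ℝ :=
  -Real.log (2 * (φ 1).re) - 3 * Real.log (2 * (φ 0).im)

/-- The superpotential `W(S, T) = Ω(S) H(T) / η(T)⁶`. -/
def superpotential (Ω H : ℂ → ℂ) (φ : Fin 2 → ℂ) : ℂ :=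
  Ω (φ 1) * H (φ 0) / ModularForm.eta (φ 0) ^ 6

/-- The scalar potential `V(T, S)` of the two-modulus model with tree-level dilaton Kähler
potential. -/
def potential (Ω H : ℂ → ℂ) : (Fin 2 → ℂ) → ℝ :=
  scalarPotential treeKahler (superpotential Ω H)

/-- The rescaled Kähler-modulus F-term `F̃_T = H_T - (3i / 2π) Ĝ₂ H`. -/
def tildeFT (H : ℂ → ℂ) (T : ℍ) : ℂ :=
  deriv H T - 3 * I / (2 * Real.pi) * hatG2 T * H T

/-- The rescaled dilaton F-term `F̃_S = Ω_S + k_S Ω` for `k = -ln(S + S̄)`, that is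
`k_S = -1 / (S + S̄)`. Class A extrema are those with `F̃_S = 0`. -/
def tildeFS (Ω : ℂ → ℂ) (S : ℂ) : ℂ :=
  deriv Ω S + -(1 / (S + conj S)) * Ω S

end HeteroticOrbifold

end

/-! The superpotential factorises as `W = Ω(S) h(T)` with `h = H/η⁶`, and the Kähler metric is
diagonal. With `x = Re S`, `y = Im T`, `F = Ω' - Ω/(2x)` and `D = h' + 3i h/(2y)`, this gives `V =
(4y²/3 |Ω|²|D|² + |h|² (4x²|F|² - 3|Ω|²)) / (16 x y³)` (`potential_apply`). At an elliptic point one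
of two degenerations occurs, and in each the criticality equation makes a mixed derivative `∂_a ∂_ā
V` negative when `V > 0`. Since this is a quarter of the trace of a diagonal 2×2 block of the
Hessian (`wirtinger_laplacian_nonneg`), no de Sitter vacuum is possible.

If `D(T₀) = 0`, only the dilaton matters: `V = c (4x|F|² - 3|Ω|²/x)`. Positivity forces `F ≠ 0`,
criticality in `S` then fixes `|2F + 4x ∂_S F| = 2|Ω|/x`, and `∂_S ∂_S̄ V = -V/(2x²) - c|Ω|²/x³ <
0`.

If `h(T₀) = 0`, then `V` is a multiple of `|Ω|²/x` on the slice `T = T₀`, so criticality in `S`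
forces `F = 0`; this is the Class A claim. On the slice `S = S₀` the potential is then of no-scale
type, criticality in `T` gives `h'' = -2i h'/y`, and `∂_T ∂_T̄ V` is a negative multiple of
`|h'|²/y³`.

Which case occurs is a modular computation. `Ĝ₂` vanishes at `i` and `ρ`, so there `D` is `H'/η⁶`.
The Serre derivatives of `E₄` and `E₆` are nonzero multiples of `E₆` and `E₄²`, because level one
weights 6 and 8 are one-dimensional. Together with `E₆(i) = 0` and `E₄(ρ) = 0`, this leaves `H'(i) ≠
0` only for `m = 1` and `H'(ρ) ≠ 0` only for `n = 1`, and in these cases `h` itself vanishes. -/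

namespace HeteroticOrbifold

/-! ### Wirtinger calculus in one complex variable -/

/-- `f` is real-differentiable at `z` with differential `p dz + q dz̄`. -/
def HasWirtingerAt (f : ℂ → ℂ) (p q z : ℂ) : Prop :=
  HasFDerivAt f (p • ContinuousLinearMap.id ℝ ℂ + q • (conjCLE : ℂ →L[ℝ] ℂ)) z

namespace HasWirtingerAt

variable {f g : ℂ → ℂ} {p q r s z : ℂ}

theorem congr_deriv (h : HasWirtingerAt f p q z) (hp : p = r) (hq : q = s) :
    HasWirtingerAt f r s z := hp ▸ hq ▸ h

theorem congr_of_eventuallyEq (h : HasWirtingerAt f p q z) (hg : g =ᶠ[nhds z] f) :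
    HasWirtingerAt g p q z :=
  HasFDerivAt.congr_of_eventuallyEq h hg

theorem const (c z : ℂ) : HasWirtingerAt (fun _ => c) 0 0 z := by
  refine (hasFDerivAt_const (𝕜 := ℝ) c z).congr_fderiv ?_
  ext
  simp

theorem _root_.HasDerivAt.hasWirtingerAt {f' : ℂ} (h : HasDerivAt f f' z) :
    HasWirtingerAt f f' 0 z := by
  refine (h.hasFDerivAt.restrictScalars ℝ).congr_fderiv ?_
  ext
  simp [mul_comm]

theorem conjugate (h : HasWirtingerAt f p q z) :
    HasWirtingerAt (fun w => conj (f w)) (conj q) (conj p) z := by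
  refine ((conjCLE : ℂ →L[ℝ] ℂ).hasFDerivAt.comp z h).congr_fderiv ?_
  ext
  simp [add_comm]

theorem add (hf : HasWirtingerAt f p q z) (hg : HasWirtingerAt g r s z) :
    HasWirtingerAt (fun w => f w + g w) (p + r) (q + s) z := by
  refine (HasFDerivAt.add hf hg).congr_fderiv ?_
  ext
  simp
  ring

theorem neg (hf : HasWirtingerAt f p q z) :
    HasWirtingerAt (fun w => -f w) (-p) (-q) z := by
  refine (HasFDerivAt.neg hf).congr_fderiv ?_
  ext
  simp
  ring

theorem sub (hf : HasWirtingerAt f p q z) (hg : HasWirtingerAt g r s z) :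
    HasWirtingerAt (fun w => f w - g w) (p - r) (q - s) z := by
  simpa [sub_eq_add_neg] using hf.add hg.neg

theorem mul (hf : HasWirtingerAt f p q z) (hg : HasWirtingerAt g r s z) :
    HasWirtingerAt (fun w => f w * g w) (p * g z + f z * r) (q * g z + f z * s) z := by
  refine (HasFDerivAt.mul hf hg).congr_fderiv ?_
  ext
  simp
  ring

theorem const_mul (c : ℂ) (hf : HasWirtingerAt f p q z) :
    HasWirtingerAt (fun w => c * f w) (c * p) (c * q) z :=
  ((const c z).mul hf).congr_deriv (by simp) (by simp)

theorem comp_hasDerivAt {g' : ℂ} (hg : HasDerivAt g g' (f z)) (hf : HasWirtingerAt f p q z) :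
    HasWirtingerAt (fun w => g (f w)) (g' * p) (g' * q) z := by
  refine ((hg.hasFDerivAt.restrictScalars ℝ).comp z hf).congr_fderiv ?_
  ext
  simp
  ring

theorem inv (hf : HasWirtingerAt f p q z) (h0 : f z ≠ 0) :
    HasWirtingerAt (fun w => (f w)⁻¹) (-p / f z ^ 2) (-q / f z ^ 2) z :=
  (hf.comp_hasDerivAt (hasDerivAt_inv h0)).congr_deriv (by ring) (by ring)

theorem div (hf : HasWirtingerAt f p q z) (hg : HasWirtingerAt g r s z) (h0 : g z ≠ 0) :
    HasWirtingerAt (fun w => f w / g w) ((p * g z - f z * r) / g z ^ 2)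
      ((q * g z - f z * s) / g z ^ 2) z := by
  simp only [div_eq_mul_inv]
  refine (hf.mul (hg.inv h0)).congr_deriv ?_ ?_ <;> field_simp <;> ring

theorem pow (hf : HasWirtingerAt f p q z) (n : ℕ) :
    HasWirtingerAt (fun w => f w ^ n) (n * f z ^ (n - 1) * p) (n * f z ^ (n - 1) * q) z :=
  hf.comp_hasDerivAt (hasDerivAt_pow n (f z))

/-- The differential has zero imaginary part; testing it on `1` and `I` determines `q`. For real
potentials it therefore suffices to track the holomorphic derivative. -/
theorem eq_of_ofReal {u : ℂ → ℝ} (h : HasWirtingerAt (fun w => (u w : ℂ)) p q z) :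
    q = starRingEnd ℂ p := by
  have hr : ∀ w, (p * w + q * starRingEnd ℂ w).im = 0 := by
    intro w
    have h2 := ((imCLM : ℂ →L[ℝ] ℝ).hasFDerivAt.comp z h)
    have h3 : HasFDerivAt (imCLM ∘ fun w => (u w : ℂ)) (0 : ℂ →L[ℝ] ℝ) z := by
      have : (imCLM ∘ fun w => (u w : ℂ)) = fun _ => (0 : ℝ) := by ext; simp
      rw [this]; exact hasFDerivAt_const _ _
    have := congrArg (fun L : ℂ →L[ℝ] ℝ => L w) (h2.unique h3)
    simpa using this
  have h1 := hr 1
  have h2 := hr I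
  simp at h1 h2
  apply Complex.ext <;> simp <;> linarith

end HasWirtingerAt

/-- Restriction to the line through `φ` in the coordinate direction `a`. -/
theorem hasFDerivAt_update_apply {E : Type*} [NormedAddCommGroup E] [NormedSpace ℝ E]
    {f : (Fin 2 → ℂ) → E} {φ : Fin 2 → ℂ} {a : Fin 2} {z : ℂ}
    (hf : DifferentiableAt ℝ f (Function.update φ a z)) :
    HasFDerivAt (fun w => f (Function.update φ a w))
      ((fderiv ℝ f (Function.update φ a z)).comp (ContinuousLinearMap.single ℝ (fun _ => ℂ) a)) z := by
  refine hf.hasFDerivAt.comp z ((hasFDerivAt_update φ z).congr_fderiv ?_)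
  ext
  simp [Pi.single_apply]
  split_ifs <;> simp

theorem HasWirtingerAt.fderiv_single {f : (Fin 2 → ℂ) → ℂ} {φ : Fin 2 → ℂ} {a : Fin 2} {z p q : ℂ}
    (h : HasWirtingerAt (fun w => f (Function.update φ a w)) p q z)
    (hf : DifferentiableAt ℝ f (Function.update φ a z)) (w : ℂ) :
    fderiv ℝ f (Function.update φ a z) (Pi.single a w) = p * w + q * conj w := by
  have := congrArg (fun L : ℂ →L[ℝ] ℂ => L w) ((hasFDerivAt_update_apply hf).unique h)
  simpa using this

theorem HasWirtingerAt.wirtinger_eq {f : (Fin 2 → ℂ) → ℂ} {φ : Fin 2 → ℂ} {a : Fin 2} {p q : ℂ}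
    (h : HasWirtingerAt (fun w => f (Function.update φ a w)) p q (φ a))
    (hf : DifferentiableAt ℝ f φ) : wirtinger a f φ = p ∧ wirtingerBar a f φ = q := by
  have := h.fderiv_single (by simpa using hf)
  simp only [Function.update_eq_self] at this
  simp only [wirtinger, wirtingerBar, this, map_one, conj_I]
  constructor
  · linear_combination (-p / 2 + q / 2) * I_sq
  · linear_combination (p / 2 - q / 2) * I_sq

theorem wirtinger_eq_of_exists {f : (Fin 2 → ℂ) → ℂ} {φ : Fin 2 → ℂ} {a : Fin 2} {p : ℂ}
    (h : ∃ q, HasWirtingerAt (fun w => f (Function.update φ a w)) p q (φ a))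
    (hf : DifferentiableAt ℝ f φ) : wirtinger a f φ = p :=
  (h.choose_spec.wirtinger_eq hf).1

/-! ### The Hessian -/

section Hessian

variable {V : (Fin 2 → ℂ) → ℝ} {φ : Fin 2 → ℂ}

theorem differentiableAt_fderiv (hV : ContDiffAt ℝ 2 V φ) : DifferentiableAt ℝ (fderiv ℝ V) φ :=
  (hV.fderiv_right (m := 1) (by norm_num)).differentiableAt (by norm_num)

theorem hessian_apply (hV : ContDiffAt ℝ 2 V φ) (i j : Fin 4) :
    hessian V φ i j = fderiv ℝ (fderiv ℝ V) φ (realDirection i) (realDirection j) := by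
  rw [hessian, Matrix.of_apply, fderiv_clm_apply (differentiableAt_fderiv hV) (by fun_prop)]
  simp

theorem hessian_isHermitian (hV : ContDiffAt ℝ 2 V φ) : (hessian V φ).IsHermitian := by
  ext i j
  simp only [Matrix.conjTranspose_apply, star_trivial, hessian_apply hV]
  exact (hV.isSymmSndFDerivAt (by simp)) _ _

/-- Symmetry of second derivatives turns the eigenvalue condition into positive semidefiniteness. -/
theorem IsDeSitterVacuum.hessian_diag_nonneg (hV : ContDiffAt ℝ 2 V φ) (h : IsDeSitterVacuum V φ)
    (i : Fin 4) : 0 ≤ hessian V φ i i := by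
  have hH := hessian_isHermitian hV
  refine (hH.posSemidef_iff_eigenvalues_nonneg.mpr fun k => h.2.2 _ ?_).diag_nonneg
  rw [Module.End.hasEigenvalue_iff_mem_spectrum, Matrix.spectrum_toLin']
  exact hH.eigenvalues_mem_spectrum_real k

/-- Here `p` is `∂_a V` along the slice and `r` its `∂_ā` derivative. Reality gives `dV(w) = 2 Re(p
w)`, so the second derivatives along `1` and `I` add up to `4 Re r`, the `s` terms cancelling. -/
theorem IsDeSitterVacuum.wirtinger_laplacian_nonneg (hV : ContDiffAt ℝ 2 V φ)
    (h : IsDeSitterVacuum V φ) (a : Fin 2) {p : ℂ → ℂ} {r : ℂ}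
    (hp : ∀ᶠ z in nhds (φ a),
      ∃ q, HasWirtingerAt (fun w => (V (Function.update φ a w) : ℂ)) (p z) q z)
    (hr : ∃ s, HasWirtingerAt p s r (φ a)) : 0 ≤ r.re := by
  obtain ⟨s, hr⟩ := hr
  have hd : ∀ w : ℂ, fderiv ℝ (fderiv ℝ V) φ (Pi.single a w) (Pi.single a w) =
      2 * ((s * w + r * conj w) * w).re := by
    intro w
    have hdiff : DifferentiableAt ℝ (fun ψ => fderiv ℝ V ψ (Pi.single a w)) φ :=
      (differentiableAt_fderiv hV).clm_apply (by fun_prop)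
    have h1 := hasFDerivAt_update_apply (φ := φ) (a := a) (z := φ a)
      (f := fun ψ => fderiv ℝ V ψ (Pi.single a w)) (by simpa using hdiff)
    have hVd : ∀ᶠ z in nhds (φ a), DifferentiableAt ℝ V (Function.update φ a z) := by
      have hc : ContinuousAt (fun z => Function.update φ a z) (φ a) :=
        (hasFDerivAt_update (𝕜 := ℝ) φ (φ a)).continuousAt
      have := (hV.eventually (by simp)).mono fun ψ hψ => hψ.differentiableAt (by norm_num)
      refine hc.eventually ?_
      simpa using this
    have h2 : (fun z => fderiv ℝ V (Function.update φ a z) (Pi.single a w)) =ᶠ[nhds (φ a)]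
        fun z => 2 * reCLM (p z * w) := by
      filter_upwards [hp, hVd] with z ⟨q, hz⟩ hVz
      have h3 := ((ofRealCLM : ℝ →L[ℝ] ℂ).hasFDerivAt.comp _ hVz.hasFDerivAt)
      have h4 := hz.fderiv_single (f := fun ψ => (V ψ : ℂ)) h3.differentiableAt w
      rw [show (fun ψ => (V ψ : ℂ)) = ofRealCLM ∘ V from rfl, h3.fderiv, hz.eq_of_ofReal] at h4
      have := congrArg re h4
      simp at this
      simp [this]
      ring
    have h5 : HasFDerivAt (fun z => 2 * reCLM (p z * w)) _ (φ a) :=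
      (reCLM.hasFDerivAt.comp (φ a) (HasFDerivAt.mul_const hr w)).const_mul 2
    have h6 := congrArg (fun L : ℂ →L[ℝ] ℝ => L w) ((h5.congr_of_eventuallyEq h2).unique h1)
    simp only [Function.update_eq_self] at h6
    rw [fderiv_clm_apply (differentiableAt_fderiv hV) (by fun_prop)] at h6
    simp at h6
    rw [← h6]
    simp
    ring
  have hsum : 0 ≤ 2 * ((s * 1 + r * conj 1) * 1).re + 2 * ((s * I + r * conj I) * I).re := by
    rw [← hd, ← hd]
    have := fun i => hessian_apply hV i i ▸ h.hessian_diag_nonneg hV i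
    fin_cases a
    · exact add_nonneg (this 0) (this 1)
    · exact add_nonneg (this 2) (this 3)
  simp at hsum
  linarith

theorem IsExtremum.wirtinger_eq_zero (hV : DifferentiableAt ℝ V φ) (h : IsExtremum V φ) {a : Fin 2}
    {p : ℂ} (hp : ∃ q, HasWirtingerAt (fun w => (V (Function.update φ a w) : ℂ)) p q (φ a)) :
    p = 0 :=
  (wirtinger_eq_of_exists (f := fun ψ => (V ψ : ℂ)) hp
    ((ofRealCLM : ℝ →L[ℝ] ℂ).differentiableAt.comp _ hV)).symm.trans (h a)

end Hessian

/-! ### The explicit form of the scalar potential -/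

theorem hasWirtingerAt_re (z : ℂ) : HasWirtingerAt (fun w => (w.re : ℂ)) (1 / 2) (1 / 2) z := by
  refine ((ofRealCLM.comp reCLM).hasFDerivAt (x := z)).congr_fderiv ?_
  ext w
  apply Complex.ext <;> simp
  ring

theorem hasWirtingerAt_im (z : ℂ) : HasWirtingerAt (fun w => (w.im : ℂ)) (-I / 2) (I / 2) z := by
  refine ((ofRealCLM.comp imCLM).hasFDerivAt (x := z)).congr_fderiv ?_
  ext w
  apply Complex.ext <;> simp <;> ring

theorem HasWirtingerAt.log_ofReal {u : ℂ → ℝ} {p q z : ℂ}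
    (h : HasWirtingerAt (fun w => (u w : ℂ)) p q z) (h0 : 0 < u z) :
    HasWirtingerAt (fun w => (Real.log (u w) : ℂ)) (p / u z) (q / u z) z := by
  have hc : ContinuousAt u z := by
    simpa [Function.comp_def] using continuous_re.continuousAt.comp (HasFDerivAt.continuousAt h)
  have hlog : HasDerivAt Complex.log (u z : ℂ)⁻¹ (u z : ℂ) :=
    Complex.hasDerivAt_log (by simp [slitPlane, h0])
  refine ((h.comp_hasDerivAt hlog).congr_of_eventuallyEq ?_).congr_deriv (by ring) (by ring)
  filter_upwards [hc.eventually (lt_mem_nhds h0)] with w hw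
  exact ofReal_log hw.le

theorem hasWirtingerAt_log_re {z : ℂ} (hz : 0 < z.re) :
    HasWirtingerAt (fun w => (Real.log (2 * w.re) : ℂ)) (1 / (2 * z.re)) (1 / (2 * z.re)) z := by
  have h : HasWirtingerAt (fun w => ((2 * w.re : ℝ) : ℂ)) 1 1 z := by
    simpa using (hasWirtingerAt_re z).const_mul 2
  simpa using h.log_ofReal (by linarith)

theorem hasWirtingerAt_log_im {z : ℂ} (hz : 0 < z.im) :
    HasWirtingerAt (fun w => (Real.log (2 * w.im) : ℂ)) (-I / (2 * z.im)) (I / (2 * z.im)) z := by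
  have h : HasWirtingerAt (fun w => ((2 * w.im : ℝ) : ℂ)) (-I) I z :=
    (((hasWirtingerAt_im z).const_mul 2).congr_deriv (by ring) (by ring)).congr_of_eventuallyEq
      (by simp [Filter.EventuallyEq])
  simpa using h.log_ofReal (by linarith)

theorem differentiableAt_treeKahler {φ : Fin 2 → ℂ} (hT : 0 < (φ 0).im) (hS : 0 < (φ 1).re) :
    DifferentiableAt ℝ (fun ψ => (treeKahler ψ : ℂ)) φ := by
  refine (ofRealCLM : ℝ →L[ℝ] ℂ).differentiableAt.comp φ ?_
  have h1 : DifferentiableAt ℝ (fun ψ : Fin 2 → ℂ => (ψ 1).re) φ :=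
    reCLM.differentiableAt.comp φ (by fun_prop)
  have h0 : DifferentiableAt ℝ (fun ψ : Fin 2 → ℂ => (ψ 0).im) φ :=
    imCLM.differentiableAt.comp φ (by fun_prop)
  exact ((h1.const_mul 2).log (by positivity)).neg.sub
    (((h0.const_mul 2).log (by positivity)).const_mul 3)

theorem wirtinger_zero_treeKahler {φ : Fin 2 → ℂ} (hT : 0 < (φ 0).im) (hS : 0 < (φ 1).re) :
    wirtinger 0 (fun ψ => (treeKahler ψ : ℂ)) φ = 3 * I / (2 * (φ 0).im) ∧
    wirtingerBar 0 (fun ψ => (treeKahler ψ : ℂ)) φ = -3 * I / (2 * (φ 0).im) := by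
  refine HasWirtingerAt.wirtinger_eq ?_ (differentiableAt_treeKahler hT hS)
  refine (((HasWirtingerAt.const _ _).sub ((hasWirtingerAt_log_im hT).const_mul 3)).congr_deriv
    (by ring) (by ring)).congr_of_eventuallyEq (f := fun w =>
      -(Real.log (2 * (φ 1).re) : ℂ) - 3 * (Real.log (2 * w.im) : ℂ)) ?_
  simp [Filter.EventuallyEq, treeKahler]

theorem wirtinger_one_treeKahler {φ : Fin 2 → ℂ} (hT : 0 < (φ 0).im) (hS : 0 < (φ 1).re) :
    wirtinger 1 (fun ψ => (treeKahler ψ : ℂ)) φ = -1 / (2 * (φ 1).re) ∧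
    wirtingerBar 1 (fun ψ => (treeKahler ψ : ℂ)) φ = -1 / (2 * (φ 1).re) := by
  refine HasWirtingerAt.wirtinger_eq ?_ (differentiableAt_treeKahler hT hS)
  refine (((hasWirtingerAt_log_re hS).neg.sub (HasWirtingerAt.const _ _)).congr_deriv
    (by ring) (by ring)).congr_of_eventuallyEq (f := fun w =>
      -(Real.log (2 * w.re) : ℂ) - 3 * (Real.log (2 * (φ 0).im) : ℂ)) ?_
  simp [Filter.EventuallyEq, treeKahler]

theorem eventually_im_pos_re_pos {φ : Fin 2 → ℂ} (hT : 0 < (φ 0).im) (hS : 0 < (φ 1).re) :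
    ∀ᶠ ψ : Fin 2 → ℂ in nhds φ, 0 < (ψ 0).im ∧ 0 < (ψ 1).re := by
  have h0 : Continuous fun ψ : Fin 2 → ℂ => (ψ 0).im := by fun_prop
  have h1 : Continuous fun ψ : Fin 2 → ℂ => (ψ 1).re := by fun_prop
  exact (h0.continuousAt.eventually (lt_mem_nhds hT)).and
    (h1.continuousAt.eventually (lt_mem_nhds hS))

theorem wirtinger_congr {f g : (Fin 2 → ℂ) → ℂ} {φ : Fin 2 → ℂ} (h : f =ᶠ[nhds φ] g) (a : Fin 2) :
    wirtinger a f φ = wirtinger a g φ := by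
  simp only [wirtinger, h.fderiv_eq]

theorem kahlerMetric_treeKahler {φ : Fin 2 → ℂ} (hT : 0 < (φ 0).im) (hS : 0 < (φ 1).re) :
    kahlerMetric treeKahler φ =
      Matrix.diagonal ![3 / (4 * ((φ 0).im : ℂ) ^ 2), 1 / (4 * ((φ 1).re : ℂ) ^ 2)] := by
  have hT' : ((φ 0).im : ℂ) ≠ 0 := by exact_mod_cast hT.ne'
  have hS' : ((φ 1).re : ℂ) ≠ 0 := by exact_mod_cast hS.ne'
  -- The outer derivative needs the inner ones on a neighbourhood, not only at the point.
  have e0 : wirtingerBar 0 (fun ψ => (treeKahler ψ : ℂ)) =ᶠ[nhds φ]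
      fun ψ => -3 * I / 2 * ((ψ 0).im : ℂ)⁻¹ := by
    filter_upwards [eventually_im_pos_re_pos hT hS] with ψ hψ
    rw [(wirtinger_zero_treeKahler hψ.1 hψ.2).2]
    ring
  have e1 : wirtingerBar 1 (fun ψ => (treeKahler ψ : ℂ)) =ᶠ[nhds φ]
      fun ψ => -1 / 2 * ((ψ 1).re : ℂ)⁻¹ := by
    filter_upwards [eventually_im_pos_re_pos hT hS] with ψ hψ
    rw [(wirtinger_one_treeKahler hψ.1 hψ.2).2]
    ring
  have d0 : DifferentiableAt ℝ (fun ψ : Fin 2 → ℂ => -3 * I / 2 * ((ψ 0).im : ℂ)⁻¹) φ := by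
    have : DifferentiableAt ℝ (fun ψ : Fin 2 → ℂ => ((ψ 0).im : ℂ)) φ :=
      (ofRealCLM.comp imCLM).differentiableAt.comp φ (by fun_prop)
    exact (this.inv hT').const_mul _
  have d1 : DifferentiableAt ℝ (fun ψ : Fin 2 → ℂ => -1 / 2 * ((ψ 1).re : ℂ)⁻¹) φ := by
    have : DifferentiableAt ℝ (fun ψ : Fin 2 → ℂ => ((ψ 1).re : ℂ)) φ :=
      (ofRealCLM.comp reCLM).differentiableAt.comp φ (by fun_prop)
    exact (this.inv hS').const_mul _
  have w00 : wirtinger 0 (fun ψ : Fin 2 → ℂ => -3 * I / 2 * ((ψ 0).im : ℂ)⁻¹) φ =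
      3 / (4 * ((φ 0).im : ℂ) ^ 2) := by
    refine wirtinger_eq_of_exists ?_ d0
    simp only [Function.update_self]
    refine Exists.intro _ ((((hasWirtingerAt_im (φ 0)).inv hT').const_mul (-3 * I / 2)).congr_deriv ?_ rfl)
    field_simp
    linear_combination -4 * I_sq
  have w10 : wirtinger 1 (fun ψ : Fin 2 → ℂ => -3 * I / 2 * ((ψ 0).im : ℂ)⁻¹) φ = 0 := by
    refine wirtinger_eq_of_exists ⟨0, ?_⟩ d0
    simpa using! HasWirtingerAt.const _ _
  have w01 : wirtinger 0 (fun ψ : Fin 2 → ℂ => -1 / 2 * ((ψ 1).re : ℂ)⁻¹) φ = 0 := by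
    refine wirtinger_eq_of_exists ⟨0, ?_⟩ d1
    simpa using! HasWirtingerAt.const _ _
  have w11 : wirtinger 1 (fun ψ : Fin 2 → ℂ => -1 / 2 * ((ψ 1).re : ℂ)⁻¹) φ =
      1 / (4 * ((φ 1).re : ℂ) ^ 2) := by
    refine wirtinger_eq_of_exists ?_ d1
    simp only [Function.update_self]
    refine Exists.intro _ ((((hasWirtingerAt_re (φ 1)).inv hS').const_mul (-1 / 2)).congr_deriv ?_ rfl)
    field_simp
    norm_num
  ext a b
  fin_cases a <;> fin_cases b
  · exact (wirtinger_congr e0 0).trans (w00.trans (by simp))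
  · exact (wirtinger_congr e1 0).trans (w01.trans (by simp))
  · exact (wirtinger_congr e0 1).trans (w10.trans (by simp))
  · exact (wirtinger_congr e1 1).trans (w11.trans (by simp))

/-- `h = H / η⁶`, the `T`-dependent factor of the superpotential. -/
noncomputable def modulusFactor (H : ℂ → ℂ) (z : ℂ) : ℂ := H z / ModularForm.eta z ^ 6

/-- The rescaled F-term `D = h' + (3 i / 2 y) h` of the Kähler modulus `T = x + i y`. -/
noncomputable def modulusF (H : ℂ → ℂ) (z : ℂ) : ℂ :=
  deriv (modulusFactor H) z + 3 * I / (2 * z.im) * modulusFactor H z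

/-- The dilaton F-term `F = Ω' - Ω / (S + S̄)`. -/
noncomputable def dilatonF (Ω : ℂ → ℂ) (z : ℂ) : ℂ := deriv Ω z - Ω z / (2 * z.re)

section Potential

variable {U : Set ℂ} {Ω H : ℂ → ℂ}

theorem potential_apply {φ : Fin 2 → ℂ} (hT : 0 < (φ 0).im) (hS : 0 < (φ 1).re)
    (hΩ : DifferentiableAt ℂ Ω (φ 1))
    (hh : DifferentiableAt ℂ (modulusFactor H) (φ 0)) :
    potential Ω H φ = 1 / (16 * (φ 1).re * (φ 0).im ^ 3) *
      (4 * (φ 0).im ^ 2 / 3 * (‖Ω (φ 1)‖ ^ 2 * ‖modulusF H (φ 0)‖ ^ 2) +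
      ‖modulusFactor H (φ 0)‖ ^ 2 * (4 * (φ 1).re ^ 2 * ‖dilatonF Ω (φ 1)‖ ^ 2 -
        3 * ‖Ω (φ 1)‖ ^ 2)) := by
  set h : ℂ → ℂ := modulusFactor H with hdef
  have hW : superpotential Ω H = fun ψ => Ω (ψ 1) * h (ψ 0) := by
    ext ψ
    simp [superpotential, hdef, modulusFactor, mul_div_assoc]
  have hWd : DifferentiableAt ℝ (superpotential Ω H) φ := by
    rw [hW]
    have p0 : DifferentiableAt ℝ (fun ψ : Fin 2 → ℂ => ψ 0) φ := by fun_prop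
    have p1 : DifferentiableAt ℝ (fun ψ : Fin 2 → ℂ => ψ 1) φ := by fun_prop
    exact DifferentiableAt.mul (DifferentiableAt.comp (g := Ω) φ (hΩ.restrictScalars ℝ) p1)
      (DifferentiableAt.comp (g := h) φ (hh.restrictScalars ℝ) p0)
  have hW0 : wirtinger 0 (superpotential Ω H) φ = Ω (φ 1) * deriv h (φ 0) := by
    refine wirtinger_eq_of_exists ⟨0, ?_⟩ hWd
    simpa [hW] using hh.hasDerivAt.hasWirtingerAt.const_mul (Ω (φ 1))
  have hW1 : wirtinger 1 (superpotential Ω H) φ = h (φ 0) * deriv Ω (φ 1) := by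
    refine wirtinger_eq_of_exists ⟨0, ?_⟩ hWd
    simpa [hW, mul_comm] using hΩ.hasDerivAt.hasWirtingerAt.const_mul (h (φ 0))
  have hF0 : fTerm treeKahler (superpotential Ω H) 0 φ =
      Ω (φ 1) * modulusF H (φ 0) := by
    rw [fTerm, modulusF, ← hdef, hW0, (wirtinger_zero_treeKahler hT hS).1, hW]
    ring
  have hF1 : fTerm treeKahler (superpotential Ω H) 1 φ =
      h (φ 0) * dilatonF Ω (φ 1) := by
    rw [fTerm, dilatonF, hW1, (wirtinger_one_treeKahler hT hS).1, hW]
    ring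
  have hT' : ((φ 0).im : ℂ) ≠ 0 := by exact_mod_cast hT.ne'
  have hS' : ((φ 1).re : ℂ) ≠ 0 := by exact_mod_cast hS.ne'
  have hinv : ((kahlerMetric treeKahler φ).transpose)⁻¹ =
      Matrix.diagonal ![4 * ((φ 0).im : ℂ) ^ 2 / 3, 4 * ((φ 1).re : ℂ) ^ 2] := by
    rw [kahlerMetric_treeKahler hT hS, Matrix.diagonal_transpose]
    refine Matrix.inv_eq_right_inv ?_
    rw [Matrix.diagonal_mul_diagonal, ← Matrix.diagonal_one]
    congr 1
    ext i
    fin_cases i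
    · simpa using hT.ne'
    · simp
      field_simp
  -- `e^K = 1/(2x (2y)³)`.
  have hexp : Real.exp (treeKahler φ) = 1 / (16 * (φ 1).re * (φ 0).im ^ 3) := by
    rw [treeKahler, sub_eq_add_neg, Real.exp_add, Real.exp_neg, Real.exp_log (by positivity),
      Real.exp_neg, mul_comm (3 : ℝ), Real.exp_mul, Real.exp_log (by positivity)]
    norm_cast
    field_simp
    norm_num
  have hWn : ‖superpotential Ω H φ‖ ^ 2 = ‖Ω (φ 1)‖ ^ 2 * ‖h (φ 0)‖ ^ 2 := by
    simp [hW, mul_pow]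
  rw [potential, scalarPotential, hinv, hexp, hWn]
  congr 1
  have key : ∀ (c : ℝ) (z : ℂ), ((c : ℂ) * z * conj z).re = c * ‖z‖ ^ 2 := by
    intro c z
    rw [mul_assoc, mul_conj, normSq_eq_norm_sq, ← ofReal_mul, ofReal_re]
  have k0 := key (4 * (φ 0).im ^ 2 / 3) (fTerm treeKahler (superpotential Ω H) 0 φ)
  have k1 := key (4 * (φ 1).re ^ 2) (fTerm treeKahler (superpotential Ω H) 1 φ)
  push_cast at k0 k1
  simp only [Fin.sum_univ_two, Matrix.diagonal_apply_eq, Matrix.cons_val_zero, Matrix.cons_val_one,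
    Matrix.diagonal_apply_ne _ (zero_ne_one (α := Fin 2)),
    Matrix.diagonal_apply_ne _ (one_ne_zero (α := Fin 2)), zero_mul, add_zero, zero_add, add_re,
    k0, k1]
  rw [hF0, hF1, norm_mul, norm_mul]
  ring

/-- Makes the `fderiv`-based Hessian a genuine symmetric second derivative: near the point `V` is an
algebraic expression in `x`, `y`, holomorphic functions and squared norms. -/
theorem contDiffAt_potential {φ : Fin 2 → ℂ} (hT : 0 < (φ 0).im) (hU : IsOpen U)
    (hU_re : U ⊆ {S : ℂ | 0 < S.re}) (hΩ : DifferentiableOn ℂ Ω U) (hS : φ 1 ∈ U)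
    (hh : DifferentiableOn ℂ (modulusFactor H) {z | 0 < z.im}) :
    ContDiffAt ℝ 2 (potential Ω H) φ := by
  have hO : IsOpen {z : ℂ | 0 < z.im} := isOpen_lt continuous_const continuous_im
  have c0 : ContDiffAt ℝ 2 (fun ψ : Fin 2 → ℂ => ψ 0) φ := by fun_prop
  have c1 : ContDiffAt ℝ 2 (fun ψ : Fin 2 → ℂ => ψ 1) φ := by fun_prop
  have lift : ∀ {f : ℂ → ℂ} {O : Set ℂ} {a : Fin 2}, IsOpen O → DifferentiableOn ℂ f O → φ a ∈ O →
      ContDiffAt ℝ 2 (fun ψ => f (ψ a)) φ := by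
    intro f O a hO hf ha
    have h1 : ContDiffAt ℝ 2 f (φ a) :=
      ((hf.contDiffOn hO).contDiffAt (hO.mem_nhds ha)).restrict_scalars ℝ
    exact h1.comp φ (by fun_prop)
  have cx : ContDiffAt ℝ 2 (fun ψ : Fin 2 → ℂ => (ψ 1).re) φ :=
    reCLM.contDiff.contDiffAt.comp φ c1
  have cy : ContDiffAt ℝ 2 (fun ψ : Fin 2 → ℂ => (ψ 0).im) φ :=
    imCLM.contDiff.contDiffAt.comp φ c0
  have cX : ContDiffAt ℝ 2 (fun ψ : Fin 2 → ℂ => ((ψ 1).re : ℂ)) φ :=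
    ofRealCLM.contDiff.contDiffAt.comp φ cx
  have cY : ContDiffAt ℝ 2 (fun ψ : Fin 2 → ℂ => ((ψ 0).im : ℂ)) φ :=
    ofRealCLM.contDiff.contDiffAt.comp φ cy
  have cΩ := lift hU hΩ hS
  have cΩ' := lift hU (hΩ.deriv hU) hS
  have ch := lift (a := 0) hO hh hT
  have ch' := lift (a := 0) hO (hh.deriv hO) hT
  have hSre : 0 < (φ 1).re := hU_re hS
  have hT' : 2 * ((φ 0).im : ℂ) ≠ 0 := by simpa using hT.ne'
  have hS' : 2 * ((φ 1).re : ℂ) ≠ 0 := by simpa using hSre.ne'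
  have hUev : ∀ᶠ ψ : Fin 2 → ℂ in nhds φ, ψ 1 ∈ U :=
    (continuous_apply (1 : Fin 2)).continuousAt.eventually (hU.mem_nhds hS)
  refine ContDiffAt.congr_of_eventuallyEq ?_
    (((eventually_im_pos_re_pos hT hSre).and hUev).mono fun ψ hψ =>
      potential_apply hψ.1.1 hψ.1.2 (hΩ.differentiableAt (hU.mem_nhds hψ.2))
        (hh.differentiableAt (hO.mem_nhds hψ.1.1)))
  have hI : ContDiffAt ℝ 2 (fun ψ : Fin 2 → ℂ => 3 * I / (2 * ((ψ 0).im : ℂ))) φ := by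
    simp only [div_eq_mul_inv]
    exact contDiffAt_const.mul ((contDiffAt_const.mul cY).inv hT')
  have hD := ch'.add (hI.mul ch)
  have hF : ContDiffAt ℝ 2 (fun ψ => dilatonF Ω (ψ 1)) φ := by
    simp only [dilatonF, div_eq_mul_inv]
    exact cΩ'.sub (cΩ.mul ((contDiffAt_const.mul cX).inv hS'))
  exact ((contDiffAt_const (c := (1 : ℝ))).div ((contDiffAt_const.mul cx).mul (cy.pow 3)) (by positivity)).mul
    ((((contDiffAt_const.mul (cy.pow 2)).div_const 3).mul
      ((cΩ.norm_sq ℝ).mul (hD.norm_sq ℝ))).add ((ch.norm_sq ℝ).mul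
      (((contDiffAt_const.mul (cx.pow 2)).mul (hF.norm_sq ℝ)).sub
        (contDiffAt_const.mul (cΩ.norm_sq ℝ)))))

end Potential

/-! ### The dilaton sector -/

section Dilaton

variable {U : Set ℂ} {Ω : ℂ → ℂ} {z : ℂ}

/-- The derivative `∂_S F` of the dilaton F-term. -/
noncomputable def dilatonFS (Ω : ℂ → ℂ) (z : ℂ) : ℂ :=
  deriv (deriv Ω) z - deriv Ω z / (2 * z.re) + Ω z / (4 * (z.re : ℂ) ^ 2)

theorem hasWirtingerAt_of_differentiableOn {f : ℂ → ℂ} (hU : IsOpen U)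
    (hf : DifferentiableOn ℂ f U) (hz : z ∈ U) : HasWirtingerAt f (deriv f z) 0 z :=
  (hf.differentiableAt (hU.mem_nhds hz)).hasDerivAt.hasWirtingerAt

theorem hasWirtingerAt_dilatonF (hU : IsOpen U) (hΩ : DifferentiableOn ℂ Ω U) (hz : z ∈ U)
    (hx : 0 < z.re) :
    HasWirtingerAt (dilatonF Ω) (dilatonFS Ω z) (Ω z / (4 * (z.re : ℂ) ^ 2)) z := by
  have hx' : (z.re : ℂ) ≠ 0 := by exact_mod_cast hx.ne'
  have h0 := hasWirtingerAt_of_differentiableOn hU hΩ hz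
  have h1 := hasWirtingerAt_of_differentiableOn hU (hΩ.deriv hU) hz
  refine (h1.sub (h0.div ((hasWirtingerAt_re z).const_mul 2) (by simpa using hx'))).congr_deriv
    ?_ ?_
  · rw [dilatonFS]
    field_simp
    ring
  · field_simp
    ring

theorem hasWirtingerAt_dilatonFS (hU : IsOpen U) (hΩ : DifferentiableOn ℂ Ω U) (hz : z ∈ U)
    (hx : 0 < z.re) :
    ∃ s, HasWirtingerAt (dilatonFS Ω) s
      ((dilatonF Ω z - Ω z / (2 * z.re)) / (4 * (z.re : ℂ) ^ 2)) z := by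
  have hx' : (z.re : ℂ) ≠ 0 := by exact_mod_cast hx.ne'
  have h0 := hasWirtingerAt_of_differentiableOn hU hΩ hz
  have h1 := hasWirtingerAt_of_differentiableOn hU (hΩ.deriv hU) hz
  have h2 := hasWirtingerAt_of_differentiableOn hU ((hΩ.deriv hU).deriv hU) hz
  have hr := hasWirtingerAt_re z
  refine ⟨_, ((h2.sub (h1.div (hr.const_mul 2) (by simpa using hx'))).add
    (h0.div ((hr.pow 2).const_mul 4) (by simpa using hx'))).congr_deriv rfl ?_⟩
  rw [dilatonF]
  field_simp
  ring

/-- Up to a factor 2 the function is `e^k |Ω|²` with `k = -ln(S + S̄)`, and `F` is the covariant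
derivative of `Ω` for this metric. -/
theorem hasWirtingerAt_normSq_div_re (hU : IsOpen U) (hΩ : DifferentiableOn ℂ Ω U) (hz : z ∈ U)
    (hx : 0 < z.re) :
    HasWirtingerAt (fun w => Ω w * conj (Ω w) / w.re) (conj (Ω z) * dilatonF Ω z / z.re)
      (Ω z * conj (dilatonF Ω z) / z.re) z := by
  have hx' : (z.re : ℂ) ≠ 0 := by exact_mod_cast hx.ne'
  have h0 := hasWirtingerAt_of_differentiableOn hU hΩ hz
  refine ((h0.mul h0.conjugate).div (hasWirtingerAt_re z) hx').congr_deriv ?_ ?_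
  · simp only [dilatonF, map_zero]
    field_simp
    ring
  · simp only [dilatonF, map_sub, map_div₀, map_mul, conj_ofReal, map_ofNat]
    field_simp
    ring

theorem hasWirtingerAt_dilatonPotential (hU : IsOpen U) (hΩ : DifferentiableOn ℂ Ω U) (hz : z ∈ U)
    (hx : 0 < z.re) (C : ℂ) :
    ∃ q, HasWirtingerAt (fun w => C * (4 * (w.re * (dilatonF Ω w * conj (dilatonF Ω w))) -
        3 * (Ω w * conj (Ω w) / w.re)))
      (C * (conj (dilatonF Ω z) * (2 * dilatonF Ω z + 4 * (z.re * dilatonFS Ω z)) -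
        2 * (conj (Ω z) * dilatonF Ω z / z.re))) q z := by
  have hx' : (z.re : ℂ) ≠ 0 := by exact_mod_cast hx.ne'
  have hF := hasWirtingerAt_dilatonF hU hΩ hz hx
  refine ⟨_, (((((hasWirtingerAt_re z).mul (hF.mul hF.conjugate)).const_mul 4).sub
    ((hasWirtingerAt_normSq_div_re hU hΩ hz hx).const_mul 3)).const_mul C).congr_deriv ?_ rfl⟩
  simp only [map_div₀, map_mul, map_pow, conj_ofReal, map_ofNat]
  field_simp
  ring

/-- The result is arranged around `G = 2F + 4x ∂_S F`, because the critical equation `F̄ G = 2 Ω̄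
F/x` determines `|G|` once `F ≠ 0`. -/
theorem hasWirtingerAt_dilatonPotential_deriv (hU : IsOpen U) (hΩ : DifferentiableOn ℂ Ω U)
    (hz : z ∈ U) (hx : 0 < z.re) (C : ℂ) :
    ∃ s, HasWirtingerAt (fun w =>
        C * (conj (dilatonF Ω w) * (2 * dilatonF Ω w + 4 * (w.re * dilatonFS Ω w)) -
          2 * (conj (Ω w) * dilatonF Ω w / w.re))) s
      (C * ((2 * dilatonF Ω z + 4 * (z.re * dilatonFS Ω z)) *
        conj (2 * dilatonF Ω z + 4 * (z.re * dilatonFS Ω z)) / (4 * z.re) -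
        Ω z * conj (Ω z) / (2 * (z.re : ℂ) ^ 3) -
        2 * (dilatonF Ω z * conj (dilatonF Ω z)) / z.re)) z := by
  have hx' : (z.re : ℂ) ≠ 0 := by exact_mod_cast hx.ne'
  have hF := hasWirtingerAt_dilatonF hU hΩ hz hx
  obtain ⟨s, hFS⟩ := hasWirtingerAt_dilatonFS hU hΩ hz hx
  have h0 := hasWirtingerAt_of_differentiableOn hU hΩ hz
  have hr := hasWirtingerAt_re z
  refine ⟨_, (((hF.conjugate.mul ((hF.const_mul 2).add ((hr.mul hFS).const_mul 4))).sub
    (((h0.conjugate.mul hF).div hr hx').const_mul 2)).const_mul C).congr_deriv rfl ?_⟩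
  have hd : deriv Ω z = dilatonF Ω z + Ω z / (2 * z.re) := by
    rw [dilatonF]
    ring
  simp only [hd, map_add, map_div₀, map_mul, conj_ofReal, map_ofNat]
  field_simp
  ring

end Dilaton

/-! ### The Kähler-modulus sector -/

section Modulus

variable {O : Set ℂ} {h : ℂ → ℂ} {z : ℂ}

theorem hasWirtingerAt_noScalePotential (hO : IsOpen O) (hh : DifferentiableOn ℂ h O) (hz : z ∈ O)
    (hy : 0 < z.im) (C : ℂ) :
    ∃ q, HasWirtingerAt (fun w => C * (4 / 3 * (deriv h w * conj (deriv h w) / w.im) +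
        2 * I * ((h w * conj (deriv h w) - deriv h w * conj (h w)) / (w.im : ℂ) ^ 2)))
      (C * (4 / 3 * (deriv (deriv h) z * conj (deriv h z) / z.im) +
        8 * I / 3 * (deriv h z * conj (deriv h z) / (z.im : ℂ) ^ 2) -
        2 * I * (deriv (deriv h) z * conj (h z) / (z.im : ℂ) ^ 2) -
        2 * ((h z * conj (deriv h z) - deriv h z * conj (h z)) / (z.im : ℂ) ^ 3))) q z := by
  have hy' : (z.im : ℂ) ≠ 0 := by exact_mod_cast hy.ne'
  have h0 := hasWirtingerAt_of_differentiableOn hO hh hz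
  have h1 := hasWirtingerAt_of_differentiableOn hO (hh.deriv hO) hz
  have hi := hasWirtingerAt_im z
  refine ⟨_, (((((h1.mul h1.conjugate).div hi hy').const_mul (4 / 3)).add
    ((((h0.mul h1.conjugate).sub (h1.mul h0.conjugate)).div (hi.pow 2)
      (pow_ne_zero 2 hy')).const_mul (2 * I))).const_mul C).congr_deriv ?_ rfl⟩
  simp only [map_zero]
  field_simp
  ring_nf
  simp only [I_sq]
  ring

/-- `h z = 0` is imposed only after differentiation; it removes the terms containing `h`
undifferentiated, in particular those with `h'''`-free cross factors. -/
theorem hasWirtingerAt_noScalePotential_deriv (hO : IsOpen O) (hh : DifferentiableOn ℂ h O)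
    (hz : z ∈ O) (hy : 0 < z.im) (hz0 : h z = 0) (C : ℂ) :
    ∃ s, HasWirtingerAt (fun w => C * (4 / 3 * (deriv (deriv h) w * conj (deriv h w) / w.im) +
        8 * I / 3 * (deriv h w * conj (deriv h w) / (w.im : ℂ) ^ 2) -
        2 * I * (deriv (deriv h) w * conj (h w) / (w.im : ℂ) ^ 2) -
        2 * ((h w * conj (deriv h w) - deriv h w * conj (h w)) / (w.im : ℂ) ^ 3))) s
      (C * (4 / 3 * (deriv (deriv h) z * conj (deriv (deriv h) z) / z.im) -
        8 * I / 3 * (deriv (deriv h) z * conj (deriv h z) / (z.im : ℂ) ^ 2) +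
        8 * I / 3 * (deriv h z * conj (deriv (deriv h) z) / (z.im : ℂ) ^ 2) +
        14 / 3 * (deriv h z * conj (deriv h z) / (z.im : ℂ) ^ 3))) z := by
  have hy' : (z.im : ℂ) ≠ 0 := by exact_mod_cast hy.ne'
  have h0 := hasWirtingerAt_of_differentiableOn hO hh hz
  have h1 := hasWirtingerAt_of_differentiableOn hO (hh.deriv hO) hz
  have h2 := hasWirtingerAt_of_differentiableOn hO ((hh.deriv hO).deriv hO) hz
  have hi := hasWirtingerAt_im z
  refine ⟨_, ((((((h2.mul h1.conjugate).div hi hy').const_mul (4 / 3)).add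
    (((h1.mul h1.conjugate).div (hi.pow 2) (pow_ne_zero 2 hy')).const_mul (8 * I / 3))).sub
    (((h2.mul h0.conjugate).div (hi.pow 2) (pow_ne_zero 2 hy')).const_mul (2 * I))).sub
    ((((h0.mul h1.conjugate).sub (h1.mul h0.conjugate)).div (hi.pow 3)
      (pow_ne_zero 3 hy')).const_mul 2)).const_mul C |>.congr_deriv rfl ?_⟩
  simp only [hz0, map_zero]
  field_simp
  ring_nf
  simp only [I_sq]
  ring

end Modulus

/-! ### Instability of extrema of positive energy -/

section Instability

variable {U : Set ℂ} {Ω H : ℂ → ℂ} {T₀ S₀ : ℂ}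

theorem isOpen_im_pos : IsOpen {z : ℂ | 0 < z.im} := isOpen_lt continuous_const continuous_im

theorem ofReal_potential (hU : IsOpen U) (hU_re : U ⊆ {S : ℂ | 0 < S.re})
    (hΩ : DifferentiableOn ℂ Ω U) (hH : DifferentiableOn ℂ (modulusFactor H) {z | 0 < z.im})
    {T S : ℂ} (hT : 0 < T.im) (hS : S ∈ U) :
    (potential Ω H ![T, S] : ℂ) = 1 / (16 * S.re * (T.im : ℂ) ^ 3) *
      (4 * (T.im : ℂ) ^ 2 / 3 * ((Ω S * conj (Ω S)) * (modulusF H T * conj (modulusF H T))) +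
      (modulusFactor H T * conj (modulusFactor H T)) * (4 * (S.re : ℂ) ^ 2 *
        (dilatonF Ω S * conj (dilatonF Ω S)) - 3 * (Ω S * conj (Ω S)))) := by
  have := potential_apply (Ω := Ω) (H := H) (φ := ![T, S]) hT (hU_re hS)
    (hΩ.differentiableAt (hU.mem_nhds hS)) (hH.differentiableAt (isOpen_im_pos.mem_nhds hT))
  rw [this]
  simp only [mul_conj, normSq_eq_norm_sq]
  push_cast
  rfl

theorem contDiffAt_potential_pair (hU : IsOpen U) (hU_re : U ⊆ {S : ℂ | 0 < S.re})
    (hΩ : DifferentiableOn ℂ Ω U) (hH : DifferentiableOn ℂ (modulusFactor H) {z | 0 < z.im})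
    {T S : ℂ} (hT : 0 < T.im) (hS : S ∈ U) : ContDiffAt ℝ 2 (potential Ω H) ![T, S] :=
  contDiffAt_potential (φ := ![T, S]) hT hU hU_re hΩ hS hH

theorem update_zero_pair (T S w : ℂ) : Function.update ![T, S] 0 w = ![w, S] := by
  ext i; fin_cases i <;> rfl

theorem update_one_pair (T S w : ℂ) : Function.update ![T, S] 1 w = ![T, w] := by
  ext i; fin_cases i <;> rfl

/-- If the F-term of the modulus vanishes, then positive energy forces a dilaton instability. -/
theorem not_isDeSitterVacuum_of_modulusF_eq_zero (hU : IsOpen U)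
    (hU_re : U ⊆ {S : ℂ | 0 < S.re}) (hΩ : DifferentiableOn ℂ Ω U)
    (hH : DifferentiableOn ℂ (modulusFactor H) {z | 0 < z.im}) (hT : 0 < T₀.im) (hS : S₀ ∈ U)
    (hF : modulusF H T₀ = 0) : ¬ IsDeSitterVacuum (potential Ω H) ![T₀, S₀] := by
  intro hdS
  have hx : 0 < S₀.re := hU_re hS
  have hy' : (T₀.im : ℂ) ≠ 0 := by exact_mod_cast hT.ne'
  have hx' : (S₀.re : ℂ) ≠ 0 := by exact_mod_cast hx.ne'
  have hV2 := contDiffAt_potential_pair hU hU_re hΩ hH hT hS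
  set c : ℝ := ‖modulusFactor H T₀‖ ^ 2 / (16 * T₀.im ^ 3) with hc
  have hslice : ∀ w ∈ U, (potential Ω H ![T₀, w] : ℂ) =
      c * (4 * (w.re * (dilatonF Ω w * conj (dilatonF Ω w))) -
        3 * (Ω w * conj (Ω w) / w.re)) := by
    intro w hw
    have hw' : (w.re : ℂ) ≠ 0 := by exact_mod_cast (hU_re hw : 0 < w.re).ne'
    rw [ofReal_potential hU hU_re hΩ hH hT hw, hF, hc]
    push_cast
    rw [← conj_mul' (modulusFactor H T₀)]
    field_simp
    ring
  have hp : ∀ z ∈ U, ∃ q, HasWirtingerAt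
      (fun w => (potential Ω H (Function.update ![T₀, S₀] 1 w) : ℂ))
      (c * (conj (dilatonF Ω z) * (2 * dilatonF Ω z + 4 * (z.re * dilatonFS Ω z)) -
        2 * (conj (Ω z) * dilatonF Ω z / z.re))) q z := by
    intro z hz
    obtain ⟨q, hq⟩ := hasWirtingerAt_dilatonPotential hU hΩ hz (hU_re hz) c
    refine ⟨q, hq.congr_of_eventuallyEq ?_⟩
    filter_upwards [hU.mem_nhds hz] with w hw
    rw [update_one_pair]
    exact hslice w hw
  have hcrit := hdS.2.1.wirtinger_eq_zero (hV2.differentiableAt (by norm_num)) (a := 1)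
    (hp S₀ hS)
  have hlap := hdS.wirtinger_laplacian_nonneg hV2 1
    (Filter.eventually_of_mem (hU.mem_nhds hS) hp)
    (hasWirtingerAt_dilatonPotential_deriv hU hΩ hS hx c)
  have hpos := hdS.1
  have hv : potential Ω H ![T₀, S₀] =
      c * (4 * (S₀.re * ‖dilatonF Ω S₀‖ ^ 2) - 3 * (‖Ω S₀‖ ^ 2 / S₀.re)) := by
    have := hslice S₀ hS
    simp only [mul_conj'] at this
    exact_mod_cast this
  rw [hv] at hpos
  have hc0 : 0 ≤ c := by positivity
  -- Positive energy excludes `h(T₀) = 0` on this branch.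
  have hcpos : 0 < c := lt_of_le_of_ne hc0 fun h => by simp [← h] at hpos
  have hvpos := (mul_pos_iff_of_pos_left hcpos).1 hpos
  set G := 2 * dilatonF Ω S₀ + 4 * (S₀.re * dilatonFS Ω S₀) with hG
  have hFne : dilatonF Ω S₀ ≠ 0 := by
    intro h0
    rw [h0] at hvpos
    have : 0 ≤ 3 * (‖Ω S₀‖ ^ 2 / S₀.re) := by positivity
    simp at hvpos
    linarith
  have hGn : ‖G‖ = 2 * (‖Ω S₀‖ / S₀.re) := by
    have h1 : conj (dilatonF Ω S₀) * G = 2 * (conj (Ω S₀) * dilatonF Ω S₀ / S₀.re) := by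
      have := (mul_eq_zero.1 hcrit).resolve_left (by exact_mod_cast hcpos.ne')
      exact sub_eq_zero.1 this
    have h2 := congrArg norm h1
    simp only [norm_mul, norm_div, RCLike.norm_conj, norm_real, Real.norm_eq_abs, abs_of_pos hx,
      RCLike.norm_ofNat] at h2
    have h3 : 0 < ‖dilatonF Ω S₀‖ := norm_pos_iff.2 hFne
    refine mul_left_cancel₀ h3.ne' (h2.trans ?_)
    ring
  have hre : (c * (G * conj G / (4 * S₀.re) - Ω S₀ * conj (Ω S₀) / (2 * (S₀.re : ℂ) ^ 3) -
      2 * (dilatonF Ω S₀ * conj (dilatonF Ω S₀)) / S₀.re)).re =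
      c * (‖G‖ ^ 2 / (4 * S₀.re) - ‖Ω S₀‖ ^ 2 / (2 * S₀.re ^ 3) -
        2 * ‖dilatonF Ω S₀‖ ^ 2 / S₀.re) := by
    simp only [mul_conj']
    norm_cast
  rw [hre, hGn] at hlap
  have h4 := nonneg_of_mul_nonneg_right hlap hcpos
  -- The mixed derivative is `-V/(2x²)` minus a nonnegative term, after division by `c`.
  have h5 : (2 * (‖Ω S₀‖ / S₀.re)) ^ 2 / (4 * S₀.re) - ‖Ω S₀‖ ^ 2 / (2 * S₀.re ^ 3) -
      2 * ‖dilatonF Ω S₀‖ ^ 2 / S₀.re =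
      -(4 * (S₀.re * ‖dilatonF Ω S₀‖ ^ 2) - 3 * (‖Ω S₀‖ ^ 2 / S₀.re)) / (2 * S₀.re ^ 2) -
        ‖Ω S₀‖ ^ 2 / S₀.re ^ 3 := by
    field_simp
    ring
  rw [h5, neg_div] at h4
  have h6 : 0 < (4 * (S₀.re * ‖dilatonF Ω S₀‖ ^ 2) - 3 * (‖Ω S₀‖ ^ 2 / S₀.re)) /
      (2 * S₀.re ^ 2) := by positivity
  have h7 : 0 ≤ ‖Ω S₀‖ ^ 2 / S₀.re ^ 3 := by positivity
  linarith

/-- Where `h` vanishes, an extremum of positive energy has vanishing dilaton F-term. -/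
theorem dilatonF_eq_zero_of_modulusFactor_eq_zero (hU : IsOpen U)
    (hU_re : U ⊆ {S : ℂ | 0 < S.re}) (hΩ : DifferentiableOn ℂ Ω U)
    (hH : DifferentiableOn ℂ (modulusFactor H) {z | 0 < z.im}) (hT : 0 < T₀.im) (hS : S₀ ∈ U)
    (h0 : modulusFactor H T₀ = 0) (hpos : 0 < potential Ω H ![T₀, S₀])
    (hext : IsExtremum (potential Ω H) ![T₀, S₀]) :
    dilatonF Ω S₀ = 0 ∧ Ω S₀ ≠ 0 ∧ deriv (modulusFactor H) T₀ ≠ 0 := by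
  have hx : 0 < S₀.re := hU_re hS
  have hx' : (S₀.re : ℂ) ≠ 0 := by exact_mod_cast hx.ne'
  have hy' : (T₀.im : ℂ) ≠ 0 := by exact_mod_cast hT.ne'
  have hV2 := contDiffAt_potential_pair hU hU_re hΩ hH hT hS
  set d := deriv (modulusFactor H) T₀ with hd
  -- With `h(T₀) = 0` only the term with `D = h'` survives, so the dilaton enters through `|Ω|²/x`
  -- alone.
  have hslice : ∀ w ∈ U, (potential Ω H ![T₀, w] : ℂ) =
      d * conj d / (12 * T₀.im) * (Ω w * conj (Ω w) / w.re) := by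
    intro w hw
    have hw' : (w.re : ℂ) ≠ 0 := by exact_mod_cast (hU_re hw : 0 < w.re).ne'
    rw [ofReal_potential hU hU_re hΩ hH hT hw, modulusF, h0, ← hd]
    simp only [mul_zero, add_zero, map_zero, zero_mul]
    field_simp
    ring
  have hne : (potential Ω H ![T₀, S₀] : ℂ) ≠ 0 := by exact_mod_cast hpos.ne'
  rw [hslice S₀ hS] at hne
  have hd0 : d ≠ 0 := by
    rintro h
    simp [h] at hne
  have hΩ0 : Ω S₀ ≠ 0 := by
    rintro h
    simp [h] at hne
  refine ⟨?_, hΩ0, hd0⟩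
  have hcrit := hext.wirtinger_eq_zero (hV2.differentiableAt (by norm_num)) (a := 1)
    ⟨_, ((hasWirtingerAt_normSq_div_re hU hΩ hS hx).const_mul
      (d * conj d / (12 * T₀.im))).congr_of_eventuallyEq <| by
        filter_upwards [hU.mem_nhds hS] with w hw
        rw [update_one_pair]
        exact hslice w hw⟩
  simpa [hd0, hΩ0, hx.ne', hT.ne'] using hcrit

/-- Where `h` vanishes, positive energy forces an instability of the Kähler modulus. -/
theorem not_isDeSitterVacuum_of_modulusFactor_eq_zero (hU : IsOpen U)
    (hU_re : U ⊆ {S : ℂ | 0 < S.re}) (hΩ : DifferentiableOn ℂ Ω U)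
    (hH : DifferentiableOn ℂ (modulusFactor H) {z | 0 < z.im}) (hT : 0 < T₀.im) (hS : S₀ ∈ U)
    (h0 : modulusFactor H T₀ = 0) : ¬ IsDeSitterVacuum (potential Ω H) ![T₀, S₀] := by
  intro hdS
  have hx : 0 < S₀.re := hU_re hS
  have hx' : (S₀.re : ℂ) ≠ 0 := by exact_mod_cast hx.ne'
  have hy' : (T₀.im : ℂ) ≠ 0 := by exact_mod_cast hT.ne'
  have hV2 := contDiffAt_potential_pair hU hU_re hΩ hH hT hS
  obtain ⟨hF, hΩ0, hd0⟩ :=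
    dilatonF_eq_zero_of_modulusFactor_eq_zero hU hU_re hΩ hH hT hS h0 hdS.1 hdS.2.1
  set h := modulusFactor H with hh
  set c : ℝ := ‖Ω S₀‖ ^ 2 / (16 * S₀.re) with hc
  have hcpos : 0 < c := by positivity
  -- No-scale cancellation: with `F = 0`, the part `(4y²/3)|3i h/(2y)|² = 3|h|²` of the modulus
  -- F-term removes `-3|h|²`.
  have hslice : ∀ w : ℂ, 0 < w.im → (potential Ω H ![w, S₀] : ℂ) =
      c * (4 / 3 * (deriv h w * conj (deriv h w) / w.im) +
        2 * I * ((h w * conj (deriv h w) - deriv h w * conj (h w)) / (w.im : ℂ) ^ 2)) := by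
    intro w hw
    have hw' : (w.im : ℂ) ≠ 0 := by exact_mod_cast hw.ne'
    rw [ofReal_potential hU hU_re hΩ hH hw hS, hF, hc, modulusF, ← hh]
    push_cast
    rw [← conj_mul' (Ω S₀)]
    simp only [map_add, map_div₀, map_mul, conj_ofReal, map_ofNat, conj_I, mul_zero, map_zero]
    field_simp
    ring_nf
    simp only [I_sq]
    ring
  have hp : ∀ z ∈ {z : ℂ | 0 < z.im}, ∃ q, HasWirtingerAt
      (fun w => (potential Ω H (Function.update ![T₀, S₀] 0 w) : ℂ))
      (c * (4 / 3 * (deriv (deriv h) z * conj (deriv h z) / z.im) +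
        8 * I / 3 * (deriv h z * conj (deriv h z) / (z.im : ℂ) ^ 2) -
        2 * I * (deriv (deriv h) z * conj (h z) / (z.im : ℂ) ^ 2) -
        2 * ((h z * conj (deriv h z) - deriv h z * conj (h z)) / (z.im : ℂ) ^ 3))) q z := by
    intro z hz
    obtain ⟨q, hq⟩ := hasWirtingerAt_noScalePotential isOpen_im_pos hH hz hz c
    refine ⟨q, hq.congr_of_eventuallyEq ?_⟩
    filter_upwards [isOpen_im_pos.mem_nhds hz] with w hw
    rw [update_zero_pair]
    exact hslice w hw
  have hcrit := hdS.2.1.wirtinger_eq_zero (hV2.differentiableAt (by norm_num)) (a := 0)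
    (hp T₀ hT)
  have hlap := hdS.wirtinger_laplacian_nonneg hV2 0
    (Filter.eventually_of_mem (isOpen_im_pos.mem_nhds hT) hp)
    (hasWirtingerAt_noScalePotential_deriv isOpen_im_pos hH hT hT h0 c)
  have hc' : (c : ℂ) ≠ 0 := by exact_mod_cast hcpos.ne'
  have hcd : conj (deriv h T₀) ≠ 0 := by simpa using hd0
  have h2 : deriv (deriv h) T₀ = -2 * I * deriv h T₀ / T₀.im := by
    have h3 := (mul_eq_zero.1 hcrit).resolve_left hc'
    rw [h0] at h3
    simp only [map_zero, mul_zero, zero_mul, zero_div, sub_zero] at h3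
    field_simp at h3
    have h4 := (mul_eq_zero.1 (h3.trans (mul_zero _))).resolve_left hcd
    field_simp
    linear_combination h4 / 4
  have hval : (c : ℂ) * (4 / 3 * (deriv (deriv h) T₀ * conj (deriv (deriv h) T₀) / T₀.im) -
        8 * I / 3 * (deriv (deriv h) T₀ * conj (deriv h T₀) / (T₀.im : ℂ) ^ 2) +
        8 * I / 3 * (deriv h T₀ * conj (deriv (deriv h) T₀) / (T₀.im : ℂ) ^ 2) +
        14 / 3 * (deriv h T₀ * conj (deriv h T₀) / (T₀.im : ℂ) ^ 3)) =
      ((c * (-2 / 3 * (‖deriv h T₀‖ ^ 2 / T₀.im ^ 3)) : ℝ) : ℂ) := by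
    rw [h2]
    push_cast
    rw [← conj_mul' (deriv h T₀)]
    simp only [map_div₀, map_mul, conj_ofReal, map_neg, map_ofNat, conj_I]
    field_simp
    ring_nf
    simp only [I_sq]
    ring
  rw [hval, ofReal_re] at hlap
  have h6 : 0 < ‖deriv h T₀‖ ^ 2 / T₀.im ^ 3 := by positivity
  have h7 : c * (-2 / 3 * (‖deriv h T₀‖ ^ 2 / T₀.im ^ 3)) < 0 :=
    mul_neg_of_pos_of_neg hcpos (by linarith)
  linarith

end Instability

/-! ### Serre derivatives of Eisenstein series -/

section Serre

open ModularForm EisensteinSeries Derivative UpperHalfPlane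
open scoped Manifold MatrixGroups

/-- Cauchy's estimate on discs of radius 1. -/
theorem isBoundedAtImInfty_normalizedDeriv {f : ℍ → ℂ} (hf : MDiff f)
    (hb : IsBoundedAtImInfty f) : IsBoundedAtImInfty (D f) := by
  rw [isBoundedAtImInfty_iff] at hb ⊢
  obtain ⟨M, A, hMA⟩ := hb
  -- Above this height the closed unit disc around `z` stays in the region where `M` bounds `f`;
  -- `max A 0` also keeps it inside the upper half-plane.
  refine ⟨‖(2 * Real.pi * Complex.I)⁻¹‖ * M, max A 0 + 2, fun z hz => ?_⟩
  rw [normalizedDerivOfComplex, norm_mul]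
  gcongr
  have him : ∀ w ∈ Metric.closedBall (z : ℂ) 1, max A 0 + 1 ≤ w.im := by
    intro w hw
    have h1 : |(w - z).im| ≤ 1 := (abs_im_le_norm _).trans (by simpa [dist_eq_norm] using hw)
    rw [sub_im] at h1
    have h2 := (abs_le.1 h1).1
    simp only [UpperHalfPlane.coe_im] at h2
    linarith
  have hpos : ∀ w ∈ Metric.closedBall (z : ℂ) 1, 0 < w.im := fun w hw => by
    linarith [him w hw, le_max_right A 0]
  rw [mdifferentiable_iff] at hf
  have := Complex.norm_deriv_le_of_forall_mem_sphere_norm_le (c := (z : ℂ)) (R := 1) (C := M)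
    (f := f ∘ ofComplex) one_pos ?_ ?_
  · simpa using this
  · exact (hf.mono fun w hw => hpos w hw).diffContOnCl_ball subset_rfl
  · intro w hw
    have hw' := Metric.sphere_subset_closedBall hw
    rw [Function.comp_apply, ofComplex_apply_of_im_pos (hpos w hw')]
    exact hMA _ (by simpa using by linarith [him w hw', le_max_left A 0])

/-- The Serre derivative of a level one modular form. -/
noncomputable def serreForm {k : ℤ} (f : ModularForm 𝒮ℒ k) : ModularForm 𝒮ℒ (k + 2) where
  toFun := serreDerivative k f
  slash_action_eq' A hA := by
    obtain ⟨γ, rfl⟩ := hA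
    have : (f : ℍ → ℂ) ∣[k] γ = f := SlashInvariantForm.slash_action_eqn f _ ⟨γ, rfl⟩
    exact serreDerivative_slash_invariant (ModularFormClass.holo f) this
  holo' := serreDerivative_mdifferentiable k (ModularFormClass.holo f)
  bdd_at_cusps' hc := by
    rw [Subgroup.IsArithmetic.isCusp_iff_isCusp_SL2Z] at hc
    rw [OnePoint.isBoundedAt_iff_forall_SL2Z hc]
    intro γ _
    have : (f : ℍ → ℂ) ∣[k] γ = f := SlashInvariantForm.slash_action_eqn f _ ⟨γ, rfl⟩
    rw [serreDerivative_slash_invariant (ModularFormClass.holo f) this]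
    have hf : IsBoundedAtImInfty f := ModularFormClass.bdd_at_infty f
    have h1 := isBoundedAtImInfty_normalizedDeriv (ModularFormClass.holo f) hf
    have h2 := (isBoundedAtImInfty_E2.mul hf).const_mul_left (-(k * 12⁻¹ : ℂ))
    have h3 : serreDerivative (k : ℂ) f = D f + fun z => -(k * 12⁻¹ : ℂ) * (E2 * f) z := by
      ext z
      simp
      ring
    rw [h3]
    exact h1.add h2

/-- Level one forms of weight 6 are spanned by `E₆`. The constant is never computed; only its being
nonzero is used later. -/
theorem exists_serreDerivative_E₄ : ∃ c : ℂ, ∀ z, serreDerivative 4 E₄ z = c * E₆ z := by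
  obtain ⟨c, hc⟩ := (finrank_eq_one_iff_of_nonzero' E₆ (E_ne_zero _ ⟨3, rfl⟩)).mp
    (Module.rank_eq_one_iff_finrank_eq_one.mp levelOne_weight_six_rank_one) (serreForm E₄)
  exact ⟨c, fun z => (congrArg (fun f : ModularForm 𝒮ℒ 6 => f z) hc).symm⟩

/-! ### Zeros of `E₄` and `E₆` at the elliptic points. -/

theorem S_smul_I : ModularGroup.S • UpperHalfPlane.I = UpperHalfPlane.I := by
  rw [modular_S_smul]
  ext
  simp [UpperHalfPlane.I]

theorem S_smul_T_smul_ρ : ModularGroup.S • ModularGroup.T • ρ = ρ := by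
  rw [modular_S_smul, modular_T_smul]
  ext
  simp only [coe_vadd, ofReal_one]
  rw [inv_eq_iff_eq_inv]
  refine eq_inv_of_mul_eq_one_left ?_
  linear_combination -ρ_sq

theorem E_S_smul {k : ℤ} (f : ModularForm 𝒮ℒ k) (z : ℍ) :
    f (ModularGroup.S • z) = (z : ℂ) ^ k * f z := by
  have h : (f : ℍ → ℂ) ∣[k] ModularGroup.S = f :=
    SlashInvariantForm.slash_action_eqn f _ ⟨ModularGroup.S, rfl⟩
  have h1 := congrFun h z
  rw [SL_slash_apply, ModularGroup.denom_S, zpow_neg, ← div_eq_mul_inv,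
    div_eq_iff (zpow_ne_zero _ z.ne_zero)] at h1
  rw [h1, mul_comm]

theorem E_T_smul {k : ℤ} (f : ModularForm 𝒮ℒ k) (z : ℍ) :
    f (ModularGroup.T • z) = f z := by
  rw [modular_T_smul]
  exact SlashInvariantForm.vAdd_apply_of_mem_strictPeriods f z one_mem_strictPeriods_SL

theorem E₆_I : E₆ UpperHalfPlane.I = 0 := by
  have h := E_S_smul E₆ UpperHalfPlane.I
  rw [S_smul_I, show ((UpperHalfPlane.I : ℍ) : ℂ) ^ (6 : ℤ) = -1 by
    rw [show ((UpperHalfPlane.I : ℍ) : ℂ) = Complex.I from rfl]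
    norm_cast
    rw [show 6 = 2 * 3 from rfl, pow_mul, I_sq]
    norm_num] at h
  linear_combination h / 2

/-- `ST` fixes `ρ` with automorphy factor `(1 + ρ)⁴ = -ρ - 1 ≠ 1`. -/
theorem E₄_ρ : E₄ ρ = 0 := by
  have h := E_S_smul E₄ (ModularGroup.T • ρ)
  rw [S_smul_T_smul_ρ, E_T_smul, modular_T_smul] at h
  have h1 : (((1 : ℝ) +ᵥ ρ : ℍ) : ℂ) ^ (4 : ℤ) = -ρ - 1 := by
    simp only [coe_vadd, ofReal_one]
    norm_cast
    linear_combination ((ρ : ℂ) ^ 2 + 3 * ρ + 2) * ρ_sq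
  rw [h1] at h
  have h2 : (ρ : ℂ) + 2 ≠ 0 := by
    intro h0
    have := congrArg Complex.re h0
    norm_num [ρ] at this
  have h3 : ((ρ : ℂ) + 2) * E₄ ρ = 0 := by linear_combination h
  exact (mul_eq_zero.1 h3).resolve_left h2

theorem E₄_cube_sub_E₆_sq (z : ℍ) : E₄ z ^ 3 - E₆ z ^ 2 = 1728 * ModularForm.eta z ^ 24 := by
  have := discriminant_eq_E₄_cube_sub_E₆_sq z
  rw [ModularForm.discriminant] at this
  linear_combination -1728 * this

theorem eta_coe_ne_zero (z : ℍ) : ModularForm.eta z ≠ 0 := eta_ne_zero z.im_pos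

theorem E₄_I_ne_zero : E₄ UpperHalfPlane.I ≠ 0 := by
  intro h
  have := E₄_cube_sub_E₆_sq UpperHalfPlane.I
  rw [h, E₆_I] at this
  exact pow_ne_zero 24 (eta_coe_ne_zero UpperHalfPlane.I) (by linear_combination -this / 1728)

theorem E₆_ρ_ne_zero : E₆ ρ ≠ 0 := by
  intro h
  have := E₄_cube_sub_E₆_sq ρ
  rw [h, E₄_ρ] at this
  exact pow_ne_zero 24 (eta_coe_ne_zero ρ) (by linear_combination -this / 1728)

theorem exists_serreDerivative_E₆ : ∃ c : ℂ, ∀ z, serreDerivative 6 E₆ z = c * E₄ z ^ 2 := by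
  have hr : Module.rank ℂ (ModularForm 𝒮ℒ 8) = 1 := by
    have := dimension_level_one 8 (by decide)
    simpa [Nat.ModEq] using this
  set f : ModularForm 𝒮ℒ 8 := ModularForm.mcast (by norm_num) (E₄.pow 2)
  have hf : ∀ z, f z = E₄ z ^ 2 := fun z => by
    rw [coe_mcast, coe_pow, Pi.pow_apply]
  have h0 : f ≠ 0 := by
    intro h
    have := hf UpperHalfPlane.I
    rw [h] at this
    exact pow_ne_zero 2 E₄_I_ne_zero this.symm
  obtain ⟨c, hc⟩ := (finrank_eq_one_iff_of_nonzero' f h0).mp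
    (Module.rank_eq_one_iff_finrank_eq_one.mp hr) (serreForm E₆)
  refine ⟨c, fun z => ?_⟩
  rw [← hf]
  exact (congrArg (fun f : ModularForm 𝒮ℒ 8 => f z) hc).symm

/-- The ratio of a weight `2 l` form and `η ^ (4 l)` has derivative `2 π i` times the Serre
derivative, divided by the same power of `η`. -/
theorem hasDerivAt_div_eta_pow {f : ℍ → ℂ} (hf : MDiff f) (l : ℕ) (z : ℍ) :
    HasDerivAt (fun w => f (ofComplex w) / ModularForm.eta w ^ (2 * l))
      (2 * Real.pi * Complex.I * serreDerivative l f z / ModularForm.eta z ^ (2 * l)) z := by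
  have hη := eta_coe_ne_zero z
  have h1 : HasDerivAt (f ∘ ofComplex) (deriv (f ∘ ofComplex) z) z :=
    (mdifferentiableAt_iff.mp (hf z)).hasDerivAt
  have h2 : HasDerivAt ModularForm.eta (Real.pi * Complex.I / 12 * E2 z * ModularForm.eta z) z := by
    have h := (differentiableAt_eta_of_mem_upperHalfPlaneSet z.im_pos).hasDerivAt
    rwa [show deriv ModularForm.eta z = Real.pi * Complex.I / 12 * E2 z * ModularForm.eta z by
      rw [← logDeriv_eta_eq_E2, logDeriv_apply, div_mul_cancel₀ _ hη]] at h
  have hD : deriv (f ∘ ofComplex) z = 2 * Real.pi * Complex.I * D f z := by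
    rw [normalizedDerivOfComplex, mul_inv_cancel_left₀ two_pi_I_ne_zero]
  refine (h1.fun_div (h2.fun_pow (2 * l)) (pow_ne_zero _ hη)).congr_deriv ?_
  rw [hD, Function.comp_apply, ofComplex_apply, serreDerivative_apply]
  -- The `2l` factors of `η` contribute `2l · πi/12 · E₂ = 2πi · (l/12) E₂`, the correction in the
  -- weight `l` Serre derivative. The case `l = 0` is separate because of the truncated exponent `2l
  -- - 1`.
  rcases l with _ | l
  · simp
  · rw [show 2 * (l + 1) - 1 = 2 * l + 1 from rfl, show 2 * (l + 1) = 2 * l + 1 + 1 from rfl]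
    simp only [pow_succ]
    push_cast
    field_simp
    ring

/-- Otherwise `f/η^(2l)` would be constant on the connected half-plane, yet it vanishes at `z` and
not at `w`. -/
theorem serreDerivative_ne_zero {f : ℍ → ℂ} (hf : MDiff f) (l : ℕ) {z w : ℍ} (hz : f z = 0)
    (hw : f w ≠ 0) : ∃ τ, serreDerivative l f τ ≠ 0 := by
  by_contra! h
  have hd : ∀ τ : ℍ, HasDerivAt (fun w => f (ofComplex w) / ModularForm.eta w ^ (2 * l)) 0 τ := fun τ => by
    have hτ := hasDerivAt_div_eta_pow hf l τ
    rwa [h τ, mul_zero, zero_div] at hτ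
  have hpre : IsPreconnected {z : ℂ | 0 < z.im} :=
    (convex_halfSpace_im_gt 0).isPreconnected
  have := isOpen_im_pos.is_const_of_deriv_eq_zero hpre
    (fun τ hτ => (hd ⟨τ, hτ⟩).differentiableAt.differentiableWithinAt)
    (fun τ hτ => (hd ⟨τ, hτ⟩).deriv) z.im_pos w.im_pos
  simp only [ofComplex_apply, hz, zero_div] at this
  exact div_ne_zero hw (pow_ne_zero _ (eta_coe_ne_zero w)) this.symm

theorem serreDerivative_E₄ :
    ∃ c : ℂ, c ≠ 0 ∧ ∀ z, serreDerivative 4 E₄ z = c * E₆ z := by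
  obtain ⟨c, hc⟩ := exists_serreDerivative_E₄
  obtain ⟨τ, hτ⟩ := serreDerivative_ne_zero (ModularFormClass.holo E₄) 4 E₄_ρ E₄_I_ne_zero
  refine ⟨c, ?_, hc⟩
  rintro rfl
  exact hτ (by simpa using hc τ)

theorem serreDerivative_E₆ :
    ∃ c : ℂ, c ≠ 0 ∧ ∀ z, serreDerivative 6 E₆ z = c * E₄ z ^ 2 := by
  obtain ⟨c, hc⟩ := exists_serreDerivative_E₆
  obtain ⟨τ, hτ⟩ := serreDerivative_ne_zero (ModularFormClass.holo E₆) 6 E₆_I E₆_ρ_ne_zero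
  refine ⟨c, ?_, hc⟩
  rintro rfl
  exact hτ (by simpa using hc τ)

end Serre

/-! ### The modular function `H` at the elliptic points -/

section EllipticPoints

open ModularForm EisensteinSeries Derivative UpperHalfPlane
open scoped Manifold MatrixGroups

theorem eisG_eq {k : ℕ} (hk : 3 ≤ k) (z : ℍ) : eisG k z = 2 * riemannZeta k * E hk z := by
  have h1 : eisG k z = ∑' v : Fin 2 → ℤ, eisSummand k v z := rfl
  have h2 : E hk z = 1 / 2 * eisensteinSeries (N := 1) 0 k z := rfl
  rw [h1, h2, tsum_eisSummand_eq_riemannZeta_mul_eisensteinSeries hk]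
  ring

theorem riemannZeta_natCast_ne_zero {k : ℕ} (hk : 3 ≤ k) : riemannZeta k ≠ 0 := by
  refine riemannZeta_ne_zero_of_one_lt_re ?_
  rw [natCast_re]
  exact_mod_cast (by lia : 1 < k)

theorem hasDerivAt_eisG_div_eta_pow {k : ℕ} (hk : 3 ≤ k) (z : ℍ) :
    HasDerivAt (fun w => eisG k w / ModularForm.eta w ^ (2 * k))
      (2 * riemannZeta k * (2 * Real.pi * Complex.I * serreDerivative k (E hk) z /
        ModularForm.eta z ^ (2 * k))) z := by
  refine ((hasDerivAt_div_eta_pow (ModularFormClass.holo (E hk)) k z).const_mul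
    (2 * riemannZeta k)).congr_of_eventuallyEq ?_
  filter_upwards [isOpen_im_pos.mem_nhds z.im_pos] with w hw
  have h := eisG_eq hk ⟨w, hw⟩
  rw [ofComplex_apply_of_im_pos hw, ← mul_div_assoc, ← h]

/-- The weight zero function `u = G₄ / η⁸`. -/
noncomputable def ratioG4 (z : ℂ) : ℂ := eisG 4 z / ModularForm.eta z ^ 8

/-- The weight zero function `v = G₆ / η¹²`. -/
noncomputable def ratioG6 (z : ℂ) : ℂ := eisG 6 z / ModularForm.eta z ^ 12

theorem ratioG4_apply (z : ℍ) :
    ratioG4 z = 2 * riemannZeta 4 * E₄ z / ModularForm.eta z ^ 8 := by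
  simpa [ratioG4] using congrArg (· / ModularForm.eta z ^ 8) (eisG_eq (k := 4) (by norm_num) z)

theorem ratioG6_apply (z : ℍ) :
    ratioG6 z = 2 * riemannZeta 6 * E₆ z / ModularForm.eta z ^ 12 := by
  simpa [ratioG6] using congrArg (· / ModularForm.eta z ^ 12) (eisG_eq (k := 6) (by norm_num) z)

theorem jInvariant_eq (z : ℂ) : jInvariant z = (ratioG4 z / (2 * riemannZeta 4)) ^ 3 := by
  rw [jInvariant, ratioG4]
  ring

theorem modularH_eq (m n : ℕ) (P : Polynomial ℂ) (z : ℂ) :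
    modularH m n P z = ratioG4 z ^ n * ratioG6 z ^ m * P.eval (jInvariant z) := rfl

theorem exists_hasDerivAt_ratioG4 :
    ∃ c : ℂ, c ≠ 0 ∧ ∀ z : ℍ, HasDerivAt ratioG4 (c * E₆ z / ModularForm.eta z ^ 8) z := by
  obtain ⟨c, hc0, hc⟩ := serreDerivative_E₄
  refine ⟨2 * riemannZeta (4 : ℕ) * (2 * Real.pi * Complex.I) * c, ?_, fun z => ?_⟩
  · exact mul_ne_zero (mul_ne_zero (mul_ne_zero two_ne_zero
      (riemannZeta_natCast_ne_zero (by norm_num))) two_pi_I_ne_zero) hc0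
  · refine (hasDerivAt_eisG_div_eta_pow (k := 4) (by norm_num) z).congr_deriv ?_
    have := hc z
    push_cast
    rw [this]
    ring

theorem exists_hasDerivAt_ratioG6 :
    ∃ c : ℂ, c ≠ 0 ∧ ∀ z : ℍ, HasDerivAt ratioG6 (c * E₄ z ^ 2 / ModularForm.eta z ^ 12) z := by
  obtain ⟨c, hc0, hc⟩ := serreDerivative_E₆
  refine ⟨2 * riemannZeta (6 : ℕ) * (2 * Real.pi * Complex.I) * c, ?_, fun z => ?_⟩
  · exact mul_ne_zero (mul_ne_zero (mul_ne_zero two_ne_zero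
      (riemannZeta_natCast_ne_zero (by norm_num))) two_pi_I_ne_zero) hc0
  · refine (hasDerivAt_eisG_div_eta_pow (k := 6) (by norm_num) z).congr_deriv ?_
    have := hc z
    push_cast
    rw [this]
    ring

theorem hasDerivAt_modularH (m n : ℕ) (P : Polynomial ℂ) {z a b : ℂ}
    (ha : HasDerivAt ratioG4 a z) (hb : HasDerivAt ratioG6 b z) :
    HasDerivAt (modularH m n P)
      ((n * ratioG4 z ^ (n - 1) * a * ratioG6 z ^ m +
          ratioG4 z ^ n * (m * ratioG6 z ^ (m - 1) * b)) * P.eval (jInvariant z) +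
        ratioG4 z ^ n * ratioG6 z ^ m * (P.derivative.eval (jInvariant z) *
          (3 * (ratioG4 z / (2 * riemannZeta 4)) ^ 2 * (a / (2 * riemannZeta 4))))) z := by
  have hj : HasDerivAt jInvariant
      (3 * (ratioG4 z / (2 * riemannZeta 4)) ^ 2 * (a / (2 * riemannZeta 4))) z := by
    rw [show jInvariant = fun z => (ratioG4 z / (2 * riemannZeta 4)) ^ 3 from
      funext jInvariant_eq]
    simpa using (ha.div_const (2 * riemannZeta 4)).fun_pow 3
  exact ((ha.fun_pow n).fun_mul (hb.fun_pow m)).fun_mul ((P.hasDerivAt _).comp z hj)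

theorem differentiableAt_modularH (m n : ℕ) (P : Polynomial ℂ) (z : ℍ) :
    DifferentiableAt ℂ (modularH m n P) z := by
  obtain ⟨a, -, ha⟩ := exists_hasDerivAt_ratioG4
  obtain ⟨b, -, hb⟩ := exists_hasDerivAt_ratioG6
  exact (hasDerivAt_modularH m n P (ha z) (hb z)).differentiableAt

theorem differentiableOn_modulusFactor_modularH (m n : ℕ) (P : Polynomial ℂ) :
    DifferentiableOn ℂ (modulusFactor (modularH m n P)) {z | 0 < z.im} := fun z hz =>
  ((differentiableAt_modularH m n P ⟨z, hz⟩).fun_div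
    ((differentiableAt_eta_of_mem_upperHalfPlaneSet hz).fun_pow 6)
    (pow_ne_zero 6 (eta_ne_zero hz))).differentiableWithinAt

/-! ### Values and derivatives of the modular functions at `i` and `ρ`. -/

theorem ratioG6_I : ratioG6 UpperHalfPlane.I = 0 := by
  rw [ratioG6_apply, E₆_I, mul_zero, zero_div]

theorem ratioG4_ρ : ratioG4 ρ = 0 := by
  rw [ratioG4_apply, E₄_ρ, mul_zero, zero_div]

theorem riemannZeta_four_ne_zero : riemannZeta 4 ≠ 0 := by
  simpa using riemannZeta_natCast_ne_zero (k := 4) (by norm_num)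

theorem riemannZeta_six_ne_zero : riemannZeta 6 ≠ 0 := by
  simpa using riemannZeta_natCast_ne_zero (k := 6) (by norm_num)

theorem ratioG4_I_ne_zero : ratioG4 UpperHalfPlane.I ≠ 0 := by
  rw [ratioG4_apply]
  exact div_ne_zero (mul_ne_zero (mul_ne_zero two_ne_zero riemannZeta_four_ne_zero) E₄_I_ne_zero)
    (pow_ne_zero _ (eta_coe_ne_zero _))

theorem ratioG6_ρ_ne_zero : ratioG6 ρ ≠ 0 := by
  rw [ratioG6_apply]
  exact div_ne_zero (mul_ne_zero (mul_ne_zero two_ne_zero riemannZeta_six_ne_zero) E₆_ρ_ne_zero)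
    (pow_ne_zero _ (eta_coe_ne_zero _))

theorem jInvariant_I : jInvariant UpperHalfPlane.I = 1728 := by
  have h := E₄_cube_sub_E₆_sq UpperHalfPlane.I
  have hη := eta_coe_ne_zero UpperHalfPlane.I
  have hζ := riemannZeta_four_ne_zero
  rw [E₆_I] at h
  rw [jInvariant_eq, ratioG4_apply]
  field_simp
  linear_combination h

theorem jInvariant_ρ : jInvariant ρ = 0 := by
  rw [jInvariant_eq, ratioG4_ρ, zero_div, zero_pow three_ne_zero]

/-- For `m = 0` the truncated exponent gives `0 ^ 0 = 1`, but the coefficient is zero. -/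
theorem natCast_mul_zero_pow (m : ℕ) : (m : ℂ) * 0 ^ (m - 1) = if m = 1 then 1 else 0 := by
  rcases m with _ | _ | m <;> simp

/-- At `i` the derivatives of `G₄/η⁸` and of `j` are multiples of `E₆(i) = 0`, so only the factor
`(G₆/η¹²)ᵐ`, with a simple zero of its base, can contribute. -/
theorem exists_deriv_modularH_I (m n : ℕ) (P : Polynomial ℂ) :
    ∃ c : ℂ, c ≠ 0 ∧ deriv (modularH m n P) UpperHalfPlane.I =
      if m = 1 then c * P.eval 1728 else 0 := by
  obtain ⟨a, -, ha⟩ := exists_hasDerivAt_ratioG4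
  obtain ⟨b, hb0, hb⟩ := exists_hasDerivAt_ratioG6
  have hη := eta_coe_ne_zero UpperHalfPlane.I
  refine ⟨ratioG4 UpperHalfPlane.I ^ n *
    (b * E₄ UpperHalfPlane.I ^ 2 / ModularForm.eta UpperHalfPlane.I ^ 12), ?_, ?_⟩
  · exact mul_ne_zero (pow_ne_zero _ ratioG4_I_ne_zero)
      (div_ne_zero (mul_ne_zero hb0 (pow_ne_zero _ E₄_I_ne_zero)) (pow_ne_zero _ hη))
  · rw [(hasDerivAt_modularH m n P (ha UpperHalfPlane.I) (hb UpperHalfPlane.I)).deriv, ratioG6_I,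
      natCast_mul_zero_pow, E₆_I, jInvariant_I]
    split_ifs <;> simp

/-- The roles are exchanged: `G₆/η¹²` has derivative proportional to `E₄(ρ)² = 0`, and `j` is a cube
with a zero at `ρ`. -/
theorem exists_deriv_modularH_ρ (m n : ℕ) (P : Polynomial ℂ) :
    ∃ c : ℂ, c ≠ 0 ∧ deriv (modularH m n P) ρ = if n = 1 then c * P.eval 0 else 0 := by
  obtain ⟨a, ha0, ha⟩ := exists_hasDerivAt_ratioG4
  obtain ⟨b, -, hb⟩ := exists_hasDerivAt_ratioG6
  have hη := eta_coe_ne_zero ρ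
  refine ⟨a * E₆ ρ / ModularForm.eta ρ ^ 8 * ratioG6 ρ ^ m, ?_, ?_⟩
  · exact mul_ne_zero (div_ne_zero (mul_ne_zero ha0 E₆_ρ_ne_zero) (pow_ne_zero _ hη))
      (pow_ne_zero _ ratioG6_ρ_ne_zero)
  · rw [(hasDerivAt_modularH m n P (ha ρ) (hb ρ)).deriv, ratioG4_ρ,
      natCast_mul_zero_pow, E₄_ρ, jInvariant_ρ]
    split_ifs <;> simp

/-- `Ĝ₂` transforms with weight 2 and `i² ≠ 1`; concretely, the `S`-transformation of `G₂` at its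
fixed point is a linear equation for `G₂(i)`. -/
theorem hatG2_I : hatG2 UpperHalfPlane.I = 0 := by
  have h := G2_S_transform UpperHalfPlane.I
  rw [S_smul_I] at h
  have hI : ((UpperHalfPlane.I : ℍ) : ℂ) = Complex.I := rfl
  have hπ : (Real.pi : ℂ) ≠ 0 := by exact_mod_cast Real.pi_ne_zero
  rw [hI, I_sq] at h
  rw [hatG2, hI, conj_I]
  field_simp at h ⊢
  ring_nf at h ⊢
  simp only [I_sq]
  linear_combination -h

theorem hatG2_ρ : hatG2 ρ = 0 := by
  have h := G2_S_transform (ModularGroup.T • ρ)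
  rw [S_smul_T_smul_ρ] at h
  have hT : G2 (ModularGroup.T • ρ) = G2 ρ := by
    have h1 := congrFun G2_T_transform ρ
    have h2 : denom ModularGroup.T ρ = 1 := by
      rw [ModularGroup.denom_apply, ModularGroup.coe_T]
      simp
    rwa [SL_slash_apply, h2, one_zpow, mul_one] at h1
  have hw : ((ModularGroup.T • ρ : ℍ) : ℂ) = 1 + ρ := by
    rw [modular_T_smul, coe_vadd, ofReal_one]
  have hw0 : (1 : ℂ) + ρ ≠ 0 := hw ▸ (ModularGroup.T • ρ).ne_zero
  have hconj : conj (ρ : ℂ) = -1 - ρ := by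
    apply Complex.ext <;> simp [ρ]
    norm_num
  have hr : 2 * (ρ : ℂ) + 1 ≠ 0 := by
    intro h0
    have := congrArg Complex.im h0
    simp [ρ] at this
  have hr1 : (ρ : ℂ) - 1 ≠ 0 := by
    intro h0
    have := congrArg Complex.re h0
    norm_num [ρ] at this
  rw [hT, hw] at h
  rw [hatG2, hconj]
  have h3 : (ρ : ℂ) - (-1 - ρ) = 2 * ρ + 1 := by ring
  rw [h3]
  field_simp at h
  -- The fixed-point equation for `ST`, solved using `(1 + ρ)² = ρ`.
  have h4 : G2 ρ = 2 * Real.pi * Complex.I * (1 + ρ) / (ρ - 1) := by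
    rw [eq_div_iff hr1]
    linear_combination h - G2 ρ * ρ_sq
  rw [h4, div_add_div _ _ hr1 (mul_ne_zero I_ne_zero hr), div_eq_zero_iff]
  left
  linear_combination 2 * Real.pi * (1 + (ρ : ℂ)) * (2 * ρ + 1) * I_sq - 4 * Real.pi * ρ_sq

/-- The factor `η⁻⁶` contributes `-6 η'/η = -(3i/2π) G₂`, and the Kähler term `3i/(2y)` is exactly
`-(3i/2π)` times the non-holomorphic part of `Ĝ₂`. -/
theorem modulusF_eq {H : ℂ → ℂ} {z : ℍ} (hH : DifferentiableAt ℂ H z) :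
    modulusF H z = tildeFT H z / ModularForm.eta z ^ 6 := by
  have hη := eta_coe_ne_zero z
  have hπ : (Real.pi : ℂ) ≠ 0 := by exact_mod_cast Real.pi_ne_zero
  have hy : (z.im : ℂ) ≠ 0 := by exact_mod_cast z.im_pos.ne'
  have h2 : HasDerivAt ModularForm.eta (Complex.I / (4 * Real.pi) * G2 z * ModularForm.eta z) z := by
    have h := (differentiableAt_eta_of_mem_upperHalfPlaneSet z.im_pos).hasDerivAt
    have hd : deriv ModularForm.eta z = Complex.I / (4 * Real.pi) * G2 z * ModularForm.eta z := by
      rw [← div_eq_iff hη, ← logDeriv_apply, logDeriv_eta_eq_E2, E2, Pi.smul_apply, smul_eq_mul,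
        riemannZeta_two]
      field_simp
      ring
    rwa [hd] at h
  have hd : deriv (modulusFactor H) z = _ :=
    (hH.hasDerivAt.fun_div (h2.fun_pow 6) (pow_ne_zero 6 hη)).deriv
  have hsub : (z : ℂ) - conj (z : ℂ) = 2 * z.im * Complex.I := by
    rw [sub_conj, UpperHalfPlane.coe_im]
    push_cast
    ring
  rw [modulusF, hd, tildeFT, hatG2, hsub, modulusFactor, UpperHalfPlane.coe_im]
  field_simp
  ring_nf
  simp only [I_sq]
  ring

end EllipticPoints

theorem tildeFS_eq_dilatonF (Ω : ℂ → ℂ) (S : ℂ) : tildeFS Ω S = dilatonF Ω S := by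
  rw [tildeFS, dilatonF, add_conj]
  push_cast
  ring

end HeteroticOrbifold
open HeteroticOrbifold in
theorem corollary2p1 (m n : ℕ) (P : Polynomial ℂ) (U : Set ℂ) (hU : IsOpen U)
    (hU_re : U ⊆ {S : ℂ | 0 < S.re}) (Ω : ℂ → ℂ) (hΩ : DifferentiableOn ℂ Ω U) :
    (∀ S₀ ∈ U,
      ¬ IsDeSitterVacuum (potential Ω (modularH m n P)) ![(UpperHalfPlane.I : ℂ), S₀] ∧
      ¬ IsDeSitterVacuum (potential Ω (modularH m n P)) ![(UpperHalfPlane.ρ : ℂ), S₀]) ∧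
    (P.eval 0 ≠ 0 → P.eval 1728 ≠ 0 →
      (tildeFT (modularH m n P) UpperHalfPlane.I = 0 ↔ m ≠ 1) ∧
      (tildeFT (modularH m n P) UpperHalfPlane.ρ = 0 ↔ n ≠ 1)) ∧
    (m = 1 → ∀ S₀ ∈ U,
      0 < potential Ω (modularH m n P) ![(UpperHalfPlane.I : ℂ), S₀] →
      IsExtremum (potential Ω (modularH m n P)) ![(UpperHalfPlane.I : ℂ), S₀] →
      tildeFS Ω S₀ = 0) ∧
    (n = 1 → ∀ S₀ ∈ U,
      0 < potential Ω (modularH m n P) ![(UpperHalfPlane.ρ : ℂ), S₀] →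
      IsExtremum (potential Ω (modularH m n P)) ![(UpperHalfPlane.ρ : ℂ), S₀] →
      tildeFS Ω S₀ = 0) := by

  have hO := differentiableOn_modulusFactor_modularH m n P
  have hI := UpperHalfPlane.I.im_pos
  have hρ := UpperHalfPlane.ρ.im_pos
  have zeroI : m = 1 → modulusFactor (modularH m n P) UpperHalfPlane.I = 0 := by
    rintro rfl
    rw [modulusFactor, modularH_eq, ratioG6_I, pow_one, mul_zero, zero_mul, zero_div]
  have zeroρ : n = 1 → modulusFactor (modularH m n P) UpperHalfPlane.ρ = 0 := by
    rintro rfl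
    rw [modulusFactor, modularH_eq, ratioG4_ρ, pow_one, zero_mul, zero_mul, zero_div]
  obtain ⟨c, hc, hcI⟩ := exists_deriv_modularH_I m n P
  obtain ⟨d, hd, hdρ⟩ := exists_deriv_modularH_ρ m n P
  have ftI : tildeFT (modularH m n P) UpperHalfPlane.I = if m = 1 then c * P.eval 1728 else 0 := by
    rw [tildeFT, hatG2_I, hcI]
    ring
  have ftρ : tildeFT (modularH m n P) UpperHalfPlane.ρ = if n = 1 then d * P.eval 0 else 0 := by
    rw [tildeFT, hatG2_ρ, hdρ]
    ring
  refine ⟨fun S₀ hS => ⟨?_, ?_⟩, fun h0 h1 => ⟨?_, ?_⟩, fun hm S₀ hS hpos hext => ?_,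
    fun hn S₀ hS hpos hext => ?_⟩
  · by_cases hm : m = 1
    · exact not_isDeSitterVacuum_of_modulusFactor_eq_zero hU hU_re hΩ hO hI hS (zeroI hm)
    · refine not_isDeSitterVacuum_of_modulusF_eq_zero hU hU_re hΩ hO hI hS ?_
      rw [modulusF_eq (differentiableAt_modularH m n P _), ftI, if_neg hm, zero_div]
  · by_cases hn : n = 1
    · exact not_isDeSitterVacuum_of_modulusFactor_eq_zero hU hU_re hΩ hO hρ hS (zeroρ hn)
    · refine not_isDeSitterVacuum_of_modulusF_eq_zero hU hU_re hΩ hO hρ hS ?_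
      rw [modulusF_eq (differentiableAt_modularH m n P _), ftρ, if_neg hn, zero_div]
  · rw [ftI]
    split_ifs with hm <;> simp [hm, hc, h1]
  · rw [ftρ]
    split_ifs with hn <;> simp [hn, hd, h0]
  · rw [tildeFS_eq_dilatonF]
    exact (dilatonF_eq_zero_of_modulusFactor_eq_zero hU hU_re hΩ hO hI hS (zeroI hm) hpos hext).1
  · rw [tildeFS_eq_dilatonF]
    exact (dilatonF_eq_zero_of_modulusFactor_eq_zero hU hU_re hΩ hO hρ hS (zeroρ hn) hpos hext).1
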